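/- **The calculus.** Types are $\sigma,\tau ::= \iota \mid \sigma\multimap\tau$. For every type $\sigma$ there are countably many ordinary variables of type $\sigma$ (set $\mathrm{Var}^\sigma$) and, disjointly, countably many stable variables of type $\sigma$ (set $\mathrm{SVar}^\sigma$). A variable in $\mathrm{Var}^{\iota}$ is *ground* ($x$), one in $\mathrm{Var}^{\sigma\multimap\tau}$ is *higher-order* ($f$), one in $\mathrm{SVar}^\sigma$ is *stable* ($\digamma$). A *basis* is a finite list of variables; $\Gamma^\iota$ means that all variables of $\Gamma$ are ground, $\Gamma^*$ that all are stable. Terms are taken up to $\alpha$-equivalence, substitution is capture-free, and typing judgements $\Gamma\vdash M:\sigma$ are derived by the following rules (a variable added to a basis by weakening or contraction is new in it, so bases of derivable judgements have no repetitions): - $\vdash 0:\iota$, $\ \vdash\mathtt{succ}:\iota\multimap\iota$, $\ \vdash\mathtt{pred}:\iota\multimap\iota$, $\ x^\iota\vdash x:\iota$, $\ f^{\sigma\multimap\tau}\vdash f:\sigma\multimap\tau$, $\ \digamma^\sigma\vdash\digamma:\sigma$; - (exchange) two adjacent variables of a basis may be swapped; (weakening) from $\Gamma\vdash M:\tau$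 infer $\Gamma,z\vdash M:\tau$ for $z$ ground or stable; (contraction) from $\Gamma,z_1,z_2\vdash M:\tau$ infer $\Gamma,z\vdash M[z/z_1,z_2]:\tau$ for $z,z_1,z_2$ all ground, or all stable of the same type; - from $\Gamma\vdash M:\sigma\multimap\tau$ and $\Delta\vdash N:\sigma$ with $\Gamma\cap\Delta=\emptyset$ infer $\Gamma,\Delta\vdash MN:\tau$; from $\Gamma\vdash M:\iota$, $\Delta\vdash P:\iota$, $\Delta\vdash Q:\iota$ with $\Gamma\cap\Delta=\emptyset$ infer $\Gamma,\Delta\vdash \ell\mathtt{if}\,M\,P\,Q:\iota$; - from $\Gamma,x^\sigma\vdash M:\tau$, $x\in\mathrm{Var}^\sigma$, infer $\Gamma\vdash\lambda x^\sigma.M:\sigma\multimap\tau$; from $\Gamma^\iota,\Delta^*,\digamma^\sigma\vdash M:\sigma$ infer $\Gamma^\iota,\Delta^*\vdash\mu\digamma.M:\sigma$. The numeral $\underline n$ is the term $\mathtt{succ}(\cdots(\mathtt{succ}\,0))$ with $n$ occurrences of $\mathtt{succ}$. **The models.** A *linear category* is a symmetric monoidal closed category $(\mathbf L,\otimes,\multimap,\mathbf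 1)$ with a symmetric monoidal comonad $(!,\delta,\varepsilon,q_{A,B},q_{\mathbf 1})$ and monoidal natural transformations $d_A:{!A}\to{!A}\otimes{!A}$, $e_A:{!A}\to\mathbf 1$ that form commutative comonoids and are coalgebra morphisms, such that every coalgebra morphism $(!A,\delta_A)\to(!B,\delta_B)$ is a comonoid morphism. An *$\mathcal S\ell\lambda$-category* is a linear category $\mathbf L$ with finite products together with - a $!$-coalgebra $(N,p)$, morphisms $0:\mathbf 1\to N$ and $succ,pred:N\to N$, and a commutative comonoid structure $c_N:N\to N\otimes N$, $w_N:N\to\mathbf 1$, such that $pred\circ(n+1)=n$ for the numerals $n=succ^n\circ 0:\mathbf 1\to N$, $0$ and $succ$ are coalgebra and comonoid morphisms, and $p:N\to{!N}$ is a comonoid morphism; - a morphism $\ell if:N\otimes(N\times N)\to N$ with $\ell if\circ(0\otimes\langle f,g\rangle)=f$ and $\ell if\circ((n+1)\otimes\langle f,g\rangle)=g$ (modulo $\mathbf 1\cong\mathbf 1\otimes\mathbf 1$) for all $n$ and all $f,g:\mathbf 1\to N$; - for every object $B$ a morphism $fix_B:{!(!B\multimap B)}\to B$ with $fix_B=\mathrm{eval}\circ(\varepsilon\otimes({!fix_B}\circ\delta))\circ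 d$. **The interpretation.** $[\![\iota]\!]=N$, $[\![\sigma\multimap\tau]\!]=[\![\sigma]\!]\multimap[\![\tau]\!]$; $[\![\emptyset]\!]=\mathbf 1$, $[\![x^\sigma,\Delta]\!]=[\![\sigma]\!]\otimes[\![\Delta]\!]$ for $x$ ordinary and $[\![\digamma^\sigma,\Delta]\!]={![\![\sigma]\!]}\otimes[\![\Delta]\!]$ for $\digamma$ stable. Structural isomorphisms of the monoidal category, in particular $[\![\Gamma,\Delta]\!]\cong[\![\Gamma]\!]\otimes[\![\Delta]\!]$, are left implicit. For $\Gamma^\iota,\Delta^*$, let $p_\Gamma\otimes\delta_\Delta$ be the tensor product of the maps $p$ (one for each ground variable of $\Gamma$) and $\delta_{[\![\sigma]\!]}$ (one for each stable variable $\digamma^\sigma$ of $\Delta$), and let $q$ also denote its iterates ${!A_1}\otimes\cdots\otimes{!A_k}\to{!(A_1\otimes\cdots\otimes A_k)}$, which is $q_{\mathbf 1}$ for $k=0$. A derivation of $\Gamma\vdash M:\sigma$ is interpreted by a morphism $[\![\Gamma\vdash M:\sigma]\!]:[\![\Gamma]\!]\to[\![\sigma]\!]$, by recursion: $0$, $\mathtt{succ}$,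 $\mathtt{pred}$ by $0$, $\mathrm{curry}(succ)$, $\mathrm{curry}(pred)$; ground and higher-order variables by identities, stable variables by $\varepsilon_{[\![\sigma]\!]}$; exchange by precomposition with the symmetry; weakening by precomposition with $w_N$ (ground) or $e_{[\![\sigma]\!]}$ (stable); contraction by precomposition with $c_N$ or $d_{[\![\sigma]\!]}$; application by $\mathrm{eval}\circ([\![M]\!]\otimes[\![N]\!])$; $\ell\mathtt{if}$ by $\ell if\circ([\![M]\!]\otimes\langle[\![P]\!],[\![Q]\!]\rangle)$; $\lambda$ by currying; and $$[\![\Gamma^\iota,\Delta^*\vdash\mu\digamma.M:\sigma]\!]=fix_{[\![\sigma]\!]}\circ{!\,\mathrm{curry}([\![\Gamma^\iota,\Delta^*,\digamma^\sigma\vdash M:\sigma]\!])}\circ q\circ(p_\Gamma\otimes\delta_\Delta).$$ **Theorem (Semantical Substitution Lemma).** In every $\mathcal S\ell\lambda$-category the following hold; in each case the judgement on the left of the equation is derivable, and the equation holds for all derivations of the judgements involved. 1. If $\Gamma,x^\iota,\Delta\vdash M:\sigma$ with $x$ ground, then for every $n\in\mathbb N$ $$[\![\Gamma,\Delta\vdash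 M[\underline n/x]:\sigma]\!]=[\![\Gamma,x^\iota,\Delta\vdash M:\sigma]\!]\circ(\mathrm{id}_{[\![\Gamma]\!]}\otimes n\otimes\mathrm{id}_{[\![\Delta]\!]}).$$ 2. If $\Gamma,f^\sigma\vdash M:\tau$ with $f$ higher-order (so $\sigma$ is an arrow type), $\Delta\vdash N:\sigma$ and $\Gamma\cap\Delta=\emptyset$, then $$[\![\Gamma,\Delta\vdash M[N/f]:\tau]\!]=[\![\Gamma,f^\sigma\vdash M:\tau]\!]\circ(\mathrm{id}_{[\![\Gamma]\!]}\otimes[\![\Delta\vdash N:\sigma]\!]).$$ 3. If $\Gamma,\digamma^\sigma\vdash M:\tau$ with $\digamma$ stable, $\Delta_1^\iota,\Delta_2^*\vdash N:\sigma$ and $\Gamma\cap(\Delta_1,\Delta_2)=\emptyset$, then $$[\![\Gamma,\Delta_1^\iota,\Delta_2^*\vdash M[N/\digamma]:\tau]\!]=[\![\Gamma,\digamma^\sigma\vdash M:\tau]\!]\circ\bigl(\mathrm{id}_{[\![\Gamma]\!]}\otimes({![\![\Delta_1^\iota,\Delta_2^*\vdash N:\sigma]\!]}\circ q\circ(p_{\Delta_1}\otimes\delta_{\Delta_2}))\bigr).$$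 -/

import Mathlib

open CategoryTheory MonoidalCategory Limits

universe v u

namespace SlLambda

/-! ### The calculus -/

/-- Types: the ground type of natural numbers and linear arrows. -/
inductive Ty : Type
  | iota : Ty
  | arr : Ty → Ty → Ty
  deriving DecidableEq

/-- Variables: `var σ i` is the `i`-th variable of `Var^σ`, `svar σ i` the `i`-th (stable)
variable of `SVar^σ`. -/
inductive Var : Type
  | var : Ty → ℕ → Var
  | svar : Ty → ℕ → Var
  deriving DecidableEq

/-- Ground variables: the elements of `Var^ι`. -/
def Var.IsGround : Var → Prop
  | .var .iota _ => True
  | _ => False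

/-- Stable variables: the elements of `SVar`. -/
def Var.IsStable : Var → Prop
  | .svar _ _ => True
  | _ => False

/-- Terms up to α-equivalence, in locally nameless form: free variables are named (`fvar`), bound
variables are de Bruijn indices (`bvar`), so that α-equivalent terms are equal. `lam σ` binds
an ordinary variable of type `σ`, `mu σ` binds a stable variable of type `σ`. -/
inductive Term : Type
  | zero : Term
  | succ : Term
  | pred : Term
  | lif : Term → Term → Term → Term
  | app : Term → Term → Term
  | fvar : Var → Term
  | bvar : ℕ → Term
  | lam : Ty → Term → Term
  | mu : Ty → Term → Term

namespace Term

/-- Turn the free variable `x` into the bound variable of the `k`-th enclosing binder. -/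
def close (x : Var) : ℕ → Term → Term
  | _, zero => zero
  | _, succ => succ
  | _, pred => pred
  | k, lif M P Q => lif (close x k M) (close x k P) (close x k Q)
  | k, app M N => app (close x k M) (close x k N)
  | k, fvar y => if y = x then bvar k else fvar y
  | _, bvar j => bvar j
  | k, lam σ M => lam σ (close x (k + 1) M)
  | k, mu σ M => mu σ (close x (k + 1) M)

/-- `M.subst x N` is the capture-free substitution `M[N/x]` (for `N` without dangling indices,
as every typable term is). -/
def subst : Term → Var → Term → Term
  | zero, _, _ => zero
  | succ, _, _ => succ
  | pred, _, _ => pred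
  | lif M P Q, x, N => lif (subst M x N) (subst P x N) (subst Q x N)
  | app M P, x, N => app (subst M x N) (subst P x N)
  | fvar y, x, N => if y = x then N else fvar y
  | bvar j, _, _ => bvar j
  | lam σ M, x, N => lam σ (subst M x N)
  | mu σ M, x, N => mu σ (subst M x N)

/-- `λ x^σ. M`, where `x` is the `i`-th variable of `Var^σ`. -/
def abs (σ : Ty) (i : ℕ) (M : Term) : Term := lam σ (close (.var σ i) 0 M)

/-- `μ ϝ. M`, where `ϝ` is the `i`-th variable of `SVar^σ`. -/
def fix (σ : Ty) (i : ℕ) (M : Term) : Term := mu σ (close (.svar σ i) 0 M)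

/-- The renaming `M[x/x₁,x₂]`. -/
def merge (M : Term) (x x₁ x₂ : Var) : Term := (M.subst x₁ (fvar x)).subst x₂ (fvar x)

/-- The numeral `n`, that is `succ (succ (… 0))`. -/
def num : ℕ → Term
  | 0 => zero
  | n + 1 => app succ (num n)

end Term

/-- A basis: a finite list of variables. -/
abbrev Basis := List Var

/-- Derivations of the typing judgement `Γ ⊢ M : σ`. A variable added to a basis by weakening or
contraction is new in it, so the bases of derivable judgements have no repetitions. -/
inductive Deriv : Basis → Term → Ty → Type
  | z : Deriv [] .zero .iota
  | s : Deriv [] .succ (.arr .iota .iota)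
  | p : Deriv [] .pred (.arr .iota .iota)
  | lif {Γ Δ : Basis} {M P Q : Term} (h : Γ.Disjoint Δ) (D : Deriv Γ M .iota)
      (D₁ : Deriv Δ P .iota) (D₂ : Deriv Δ Q .iota) : Deriv (Γ ++ Δ) (.lif M P Q) .iota
  | ex {Γ Δ : Basis} {x₁ x₂ : Var} {M : Term} {τ : Ty}
      (D : Deriv (Γ ++ x₂ :: x₁ :: Δ) M τ) : Deriv (Γ ++ x₁ :: x₂ :: Δ) M τ
  | gv (i : ℕ) : Deriv [.var .iota i] (.fvar (.var .iota i)) .iota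
  | gw {Γ : Basis} {M : Term} {τ : Ty} (i : ℕ) (h : .var .iota i ∉ Γ) (D : Deriv Γ M τ) :
      Deriv (Γ ++ [.var .iota i]) M τ
  | gc {Γ : Basis} {M : Term} {τ : Ty} (i i₁ i₂ : ℕ) (h : .var .iota i ∉ Γ)
      (D : Deriv (Γ ++ [.var .iota i₁, .var .iota i₂]) M τ) :
      Deriv (Γ ++ [.var .iota i]) (M.merge (.var .iota i) (.var .iota i₁) (.var .iota i₂)) τ
  | hv (σ τ : Ty) (i : ℕ) :
      Deriv [.var (.arr σ τ) i] (.fvar (.var (.arr σ τ) i)) (.arr σ τ)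
  | ap {Γ Δ : Basis} {M N : Term} {σ τ : Ty} (h : Γ.Disjoint Δ) (D₁ : Deriv Γ M (.arr σ τ))
      (D₂ : Deriv Δ N σ) : Deriv (Γ ++ Δ) (.app M N) τ
  | lam {Γ : Basis} {M : Term} {σ τ : Ty} (i : ℕ) (D : Deriv (Γ ++ [.var σ i]) M τ) :
      Deriv Γ (.abs σ i M) (.arr σ τ)
  | sv (σ : Ty) (i : ℕ) : Deriv [.svar σ i] (.fvar (.svar σ i)) σ
  | sc {Γ : Basis} {M : Term} {σ τ : Ty} (i i₁ i₂ : ℕ) (h : .svar σ i ∉ Γ)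
      (D : Deriv (Γ ++ [.svar σ i₁, .svar σ i₂]) M τ) :
      Deriv (Γ ++ [.svar σ i]) (M.merge (.svar σ i) (.svar σ i₁) (.svar σ i₂)) τ
  | sw {Γ : Basis} {M : Term} {σ τ : Ty} (i : ℕ) (h : .svar σ i ∉ Γ) (D : Deriv Γ M τ) :
      Deriv (Γ ++ [.svar σ i]) M τ
  | mu {Γ Δ : Basis} {M : Term} {σ : Ty} (i : ℕ) (hΓ : ∀ x ∈ Γ, x.IsGround)
      (hΔ : ∀ x ∈ Δ, x.IsStable) (D : Deriv ((Γ ++ Δ) ++ [.svar σ i]) M σ) :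
      Deriv (Γ ++ Δ) (.fix σ i M) σ

/-! ### The categorical structure -/

noncomputable section

section Curry

variable {C : Type u} [Category.{v} C] [MonoidalCategory C] [SymmetricCategory C]
  [MonoidalClosed C]

/-- The internal hom `A ⊸ B`. -/
abbrev lolli (A B : C) : C := (ihom A).obj B

/-- Currying `Hom(X ⊗ A, B) → Hom(X, A ⊸ B)`. -/
def lcurry {X A B : C} (f : X ⊗ A ⟶ B) : X ⟶ lolli A B :=
  MonoidalClosed.curry ((β_ A X).hom ≫ f)

/-- Evaluation `(A ⊸ B) ⊗ A → B`. -/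
def leval (A B : C) : lolli A B ⊗ A ⟶ B :=
  (β_ (lolli A B) A).hom ≫ (ihom.ev A).app B

end Curry

open Functor.LaxMonoidal in
/-- A linear category (Benton, Bierman, Hyland, de Paiva): a symmetric monoidal closed category
with a symmetric monoidal comonad `!` (the maps `q` being the lax monoidal structure maps `μ`
and `ε` of the functor `!`), whose free coalgebras `(!A, δ_A)` carry commutative comonoid
structures `d_A` (`comul`), `e_A` (`counit`). -/
class LinearCategory (L : Type u) [Category.{v} L] [MonoidalCategory L] [SymmetricCategory L]
    [MonoidalClosed L] where
  /-- the exponential comonad `(!, δ, ε)` -/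
  bang : Comonad L
  /-- `q`, making `!` a symmetric lax monoidal functor -/
  laxBraided : bang.toFunctor.LaxBraided
  /-- `ε` is a monoidal natural transformation -/
  counit_monoidal : NatTrans.IsMonoidal bang.ε
  /-- `δ` is a monoidal natural transformation -/
  comult_monoidal : NatTrans.IsMonoidal bang.δ
  /-- `d_A` and `e_A` -/
  comonObj : ∀ A : L, ComonObj (bang.obj A)
  comm : ∀ A : L, IsCommComonObj (bang.obj A)
  /-- `d` and `e` are natural -/
  d_natural : ∀ {A B : L} (f : A ⟶ B),
    bang.map f ≫ ComonObj.comul (X := bang.obj B) =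
      ComonObj.comul (X := bang.obj A) ≫ (bang.map f ⊗ₘ bang.map f)
  e_natural : ∀ {A B : L} (f : A ⟶ B),
    bang.map f ≫ ComonObj.counit (X := bang.obj B) = ComonObj.counit (X := bang.obj A)
  /-- `d` and `e` are monoidal -/
  d_tensor : ∀ A B : L,
    μ bang.toFunctor A B ≫ ComonObj.comul (X := bang.obj (A ⊗ B)) =
      (ComonObj.comul (X := bang.obj A) ⊗ₘ ComonObj.comul (X := bang.obj B)) ≫
        tensorμ (bang.obj A) (bang.obj A) (bang.obj B) (bang.obj B) ≫
          (μ bang.toFunctor A B ⊗ₘ μ bang.toFunctor A B)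
  d_unit : ε bang.toFunctor ≫ ComonObj.comul (X := bang.obj (𝟙_ L)) =
    (λ_ (𝟙_ L)).inv ≫ (ε bang.toFunctor ⊗ₘ ε bang.toFunctor)
  e_tensor : ∀ A B : L,
    μ bang.toFunctor A B ≫ ComonObj.counit (X := bang.obj (A ⊗ B)) =
      (ComonObj.counit (X := bang.obj A) ⊗ₘ ComonObj.counit (X := bang.obj B)) ≫
        (λ_ (𝟙_ L)).hom
  e_unit : ε bang.toFunctor ≫ ComonObj.counit (X := bang.obj (𝟙_ L)) = 𝟙 (𝟙_ L)
  /-- `d_A` and `e_A` are coalgebra morphisms -/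
  d_coalg : ∀ A : L,
    bang.δ.app A ≫ bang.map (ComonObj.comul (X := bang.obj A)) =
      ComonObj.comul (X := bang.obj A) ≫ (bang.δ.app A ⊗ₘ bang.δ.app A) ≫
        μ bang.toFunctor (bang.obj A) (bang.obj A)
  e_coalg : ∀ A : L,
    bang.δ.app A ≫ bang.map (ComonObj.counit (X := bang.obj A)) =
      ComonObj.counit (X := bang.obj A) ≫ ε bang.toFunctor
  /-- coalgebra morphisms between free coalgebras are comonoid morphisms -/
  comonHom_of_coalg : ∀ {A B : L} (f : bang.obj A ⟶ bang.obj B),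
    f ≫ bang.δ.app B = bang.δ.app A ≫ bang.map f → IsComonHom f

attribute [reducible] LinearCategory.laxBraided LinearCategory.comonObj

attribute [instance] LinearCategory.laxBraided LinearCategory.counit_monoidal
  LinearCategory.comult_monoidal LinearCategory.comonObj LinearCategory.comm

section Model

variable {L : Type u} [Category.{v} L] [MonoidalCategory L] [SymmetricCategory L]
  [MonoidalClosed L]

/-- The numeral morphism `n : 1 → N` generated by `0` and `succ`. -/
def numeral {N : L} (zero : 𝟙_ L ⟶ N) (succ : N ⟶ N) : ℕ → (𝟙_ L ⟶ N)
  | 0 => zero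
  | n + 1 => numeral zero succ n ≫ succ

variable (L)
variable [LinearCategory L]

/-- The exponential comonad. -/
abbrev bang : Comonad L := LinearCategory.bang

open Functor.LaxMonoidal in
/-- An exponential object of numerals: a `!`-coalgebra `(N, p)` with `0`, `succ`, `pred`, and a
commutative comonoid structure `c_N` (`comul`), `w_N` (`counit`), such that `0` and `succ` are
coalgebra and comonoid morphisms and `p` is a comonoid morphism. -/
structure ExpNumerals where
  /-- the coalgebra `(N, p)` -/
  N : (bang L).Coalgebra
  zero : 𝟙_ L ⟶ N.A
  succ : N.A ⟶ N.A
  pred : N.A ⟶ N.A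
  numeral_pred : ∀ n : ℕ, numeral zero succ (n + 1) ≫ pred = numeral zero succ n
  comonObj : ComonObj N.A
  comm : IsCommComonObj N.A
  zero_coalg : zero ≫ N.a = ε (bang L).toFunctor ≫ (bang L).map zero
  succ_coalg : succ ≫ N.a = N.a ≫ (bang L).map succ
  zero_counit : zero ≫ ComonObj.counit = 𝟙 (𝟙_ L)
  zero_comul : zero ≫ ComonObj.comul = (λ_ (𝟙_ L)).inv ≫ (zero ⊗ₘ zero)
  succ_comon : IsComonHom succ
  p_comon : IsComonHom N.a

attribute [instance] ExpNumerals.comonObj ExpNumerals.comm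

/-- The remaining structure of an `Sℓλ`-category on a linear category with finite products:
an exponential object of numerals, a conditional, and fix-point operators. -/
structure SlCategory [HasFiniteProducts L] extends ExpNumerals L where
  lif : N.A ⊗ (N.A ⨯ N.A) ⟶ N.A
  lif_zero : ∀ f g : 𝟙_ L ⟶ N.A,
    (λ_ (𝟙_ L)).inv ≫ (zero ⊗ₘ prod.lift f g) ≫ lif = f
  lif_succ : ∀ (n : ℕ) (f g : 𝟙_ L ⟶ N.A),
    (λ_ (𝟙_ L)).inv ≫ (numeral zero succ (n + 1) ⊗ₘ prod.lift f g) ≫ lif = g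
  fix : ∀ B : L, (bang L).obj (lolli ((bang L).obj B) B) ⟶ B
  fix_eq : ∀ B : L,
    ComonObj.comul ≫
      ((bang L).ε.app (lolli ((bang L).obj B) B) ⊗ₘ
        ((bang L).δ.app (lolli ((bang L).obj B) B) ≫ (bang L).map (fix B))) ≫
      leval ((bang L).obj B) B = fix B

/-! ### The interpretation -/

namespace SlCategory

variable {L}
variable [HasFiniteProducts L] (S : SlCategory L)

/-- Interpretation of types. -/
def ty : Ty → L
  | .iota => S.N.A
  | .arr σ τ => lolli (ty σ) (ty τ)

/-- Interpretation of a single variable of a basis. -/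
def var : Var → L
  | .var σ _ => S.ty σ
  | .svar σ _ => (bang L).obj (S.ty σ)

/-- Interpretation of bases. -/
def ctx : Basis → L
  | [] => 𝟙_ L
  | x :: Γ => S.var x ⊗ ctx Γ

/-- The canonical isomorphism `⟦Γ, Δ⟧ ≅ ⟦Γ⟧ ⊗ ⟦Δ⟧`. -/
def split : (Γ Δ : Basis) → (S.ctx (Γ ++ Δ) ≅ S.ctx Γ ⊗ S.ctx Δ)
  | [], Δ => (λ_ (S.ctx Δ)).symm
  | x :: Γ, Δ => whiskerLeftIso (S.var x) (split Γ Δ) ≪≫ (α_ (S.var x) (S.ctx Γ) (S.ctx Δ)).symm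

/-- The canonical isomorphism `⟦Γ, x⟧ ≅ ⟦Γ⟧ ⊗ ⟦x⟧`. -/
def snoc (Γ : Basis) (x : Var) : S.ctx (Γ ++ [x]) ≅ S.ctx Γ ⊗ S.var x :=
  S.split Γ [x] ≪≫ whiskerLeftIso (S.ctx Γ) (ρ_ (S.var x))

/-- The map `⟦x⟧ → !⟦x⟧` for a ground or stable variable `x`: it is `p` when `x` is ground, and
`δ` when `x` is stable. -/
def varCoalg : (x : Var) → (x.IsGround ∨ x.IsStable) → (S.var x ⟶ (bang L).obj (S.var x))
  | .var .iota _, _ => S.N.a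
  | .var (.arr _ _) _, h => (h.elim id id : False).elim
  | .svar σ _, _ => (bang L).δ.app (S.ty σ)

/-- The tensor product of the `!⟦x⟧`, for `x` in `Γ`. -/
def bangCtx : Basis → L
  | [] => 𝟙_ L
  | x :: Γ => (bang L).obj (S.var x) ⊗ bangCtx Γ

/-- `p_Γ ⊗ δ_Δ`: the tensor product of the maps `p` and `δ` over a basis of ground and stable
variables. -/
def pδ : (Γ : Basis) → (∀ x ∈ Γ, x.IsGround ∨ x.IsStable) → (S.ctx Γ ⟶ S.bangCtx Γ)
  | [], _ => 𝟙 (𝟙_ L)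
  | x :: Γ, h => S.varCoalg x (h x (by simp)) ⊗ₘ pδ Γ (fun y hy => h y (by simp [hy]))

open Functor.LaxMonoidal in
/-- The iterated `q : !A₁ ⊗ ⋯ ⊗ !Aₙ → !(A₁ ⊗ ⋯ ⊗ Aₙ)`, which is `q_1 : 1 → !1` for `n = 0`. -/
def q : (Γ : Basis) → (S.bangCtx Γ ⟶ (bang L).obj (S.ctx Γ))
  | [] => ε (bang L).toFunctor
  | x :: Γ => ((bang L).obj (S.var x) ◁ q Γ) ≫ μ (bang L).toFunctor (S.var x) (S.ctx Γ)

/-- The promotion `!f ∘ q ∘ (p_Γ ⊗ δ_Δ) : ⟦Γ, Δ⟧ → !A` of `f : ⟦Γ, Δ⟧ → A`. -/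
def promote {Γ Δ : Basis} (hΓ : ∀ x ∈ Γ, x.IsGround) (hΔ : ∀ x ∈ Δ, x.IsStable) {A : L}
    (f : S.ctx (Γ ++ Δ) ⟶ A) : S.ctx (Γ ++ Δ) ⟶ (bang L).obj A :=
  S.pδ (Γ ++ Δ) (fun x hx => (List.mem_append.1 hx).imp (hΓ x) (hΔ x)) ≫
    S.q (Γ ++ Δ) ≫ (bang L).map f

/-- Interpretation of contraction of the last two variables of a basis, along a map
`⟦x⟧ → ⟦x₁⟧ ⊗ ⟦x₂⟧`. -/
def contract (Γ : Basis) {x x₁ x₂ : Var} (c : S.var x ⟶ S.var x₁ ⊗ S.var x₂) :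
    S.ctx (Γ ++ [x]) ⟶ S.ctx (Γ ++ [x₁, x₂]) :=
  (S.snoc Γ x).hom ≫ (S.ctx Γ ◁ (c ≫ (S.var x₁ ◁ (ρ_ (S.var x₂)).inv))) ≫
    (S.split Γ [x₁, x₂]).inv

/-- Interpretation of weakening of the last variable of a basis, along a map `⟦x⟧ → 1`. -/
def weaken (Γ : Basis) {x : Var} (w : S.var x ⟶ 𝟙_ L) : S.ctx (Γ ++ [x]) ⟶ S.ctx Γ :=
  (S.snoc Γ x).hom ≫ (S.ctx Γ ◁ w) ≫ (ρ_ (S.ctx Γ)).hom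

/-- Interpretation of the exchange of two adjacent variables of a basis. -/
def exchange (Γ : Basis) (x₁ x₂ : Var) (Δ : Basis) :
    S.ctx (Γ ++ x₁ :: x₂ :: Δ) ⟶ S.ctx (Γ ++ x₂ :: x₁ :: Δ) :=
  (S.split Γ (x₁ :: x₂ :: Δ)).hom ≫
    (S.ctx Γ ◁ ((α_ (S.var x₁) (S.var x₂) (S.ctx Δ)).inv ≫
      ((β_ (S.var x₁) (S.var x₂)).hom ▷ S.ctx Δ) ≫ (α_ (S.var x₂) (S.var x₁) (S.ctx Δ)).hom)) ≫
    (S.split Γ (x₂ :: x₁ :: Δ)).inv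

/-- The interpretation `⟦Γ ⊢ M : σ⟧ : ⟦Γ⟧ → ⟦σ⟧`, by recursion on the typing derivation. -/
def den : {Γ : Basis} → {M : Term} → {σ : Ty} → Deriv Γ M σ → (S.ctx Γ ⟶ S.ty σ)
  | _, _, _, .z => S.zero
  | _, _, _, .s => lcurry ((λ_ S.N.A).hom ≫ S.succ)
  | _, _, _, .p => lcurry ((λ_ S.N.A).hom ≫ S.pred)
  | _, _, _, .lif (Γ := Γ) (Δ := Δ) _ D D₁ D₂ =>
      (S.split Γ Δ).hom ≫ (den D ⊗ₘ prod.lift (den D₁) (den D₂)) ≫ S.lif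
  | _, _, _, .ex (Γ := Γ) (Δ := Δ) (x₁ := x₁) (x₂ := x₂) D => S.exchange Γ x₁ x₂ Δ ≫ den D
  | _, _, _, .gv _ => (ρ_ S.N.A).hom
  | _, _, _, .gw (Γ := Γ) i _ D =>
      S.weaken Γ (x := .var .iota i) (ComonObj.counit (X := S.N.A)) ≫ den D
  | _, _, _, .gc (Γ := Γ) i i₁ i₂ _ D =>
      S.contract Γ (x := .var .iota i) (x₁ := .var .iota i₁) (x₂ := .var .iota i₂)
        (ComonObj.comul (X := S.N.A)) ≫ den D
  | _, _, _, .hv σ τ _ => (ρ_ (S.ty (.arr σ τ))).hom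
  | _, _, _, .ap (Γ := Γ) (Δ := Δ) (σ := σ) (τ := τ) _ D₁ D₂ =>
      (S.split Γ Δ).hom ≫ (den D₁ ⊗ₘ den D₂) ≫ leval (S.ty σ) (S.ty τ)
  | _, _, _, .lam (Γ := Γ) (σ := σ) i D => lcurry ((S.snoc Γ (.var σ i)).inv ≫ den D)
  | _, _, _, .sv σ _ => (ρ_ ((bang L).obj (S.ty σ))).hom ≫ (bang L).ε.app (S.ty σ)
  | _, _, _, .sc (Γ := Γ) (σ := σ) i i₁ i₂ _ D =>
      S.contract Γ (x := .svar σ i) (x₁ := .svar σ i₁) (x₂ := .svar σ i₂)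
        (ComonObj.comul (X := (bang L).obj (S.ty σ))) ≫ den D
  | _, _, _, .sw (Γ := Γ) (σ := σ) i _ D =>
      S.weaken Γ (x := .svar σ i) (ComonObj.counit (X := (bang L).obj (S.ty σ))) ≫ den D
  | _, _, _, .mu (Γ := Γ) (Δ := Δ) (σ := σ) i hΓ hΔ D =>
      S.promote hΓ hΔ (lcurry ((S.snoc (Γ ++ Δ) (.svar σ i)).inv ≫ den D)) ≫ S.fix (S.ty σ)

end SlCategory

end Model

end

end SlLambda

/-! ### Resources: splitting, dropping and promoting the empty resource -/

namespace SlLambda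

noncomputable section

open Functor.LaxMonoidal

/-! A plain induction on the derivation of `M` does not work. The equation is claimed for every
derivation of the substituted judgement, and contraction turns a substitution for one variable into
a substitution for two. Both difficulties disappear with a denotation that does not refer to
derivations.

The relation `Sem A r M τ g` follows the structure of the term. An environment `A` offers values for
variables, defined on objects indexed by resources, and a resource records which linear
(higher-order) variables are consumed. A ground or stable variable has a single resource: its object
is a coalgebra with a compatible commutative comonoid, so it is split by the comultiplication,
dropped by the counit and promoted by the coalgebra map. The "empty" resource therefore means that
no linear variable is used. Exchange, weakening and contraction leave no trace here, because sharing
happens where a resource is split at an application or a conditional. The term then determines its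
type, its resource and its morphism: this is `Sem.unique`.

Soundness (`Sem.sound`) is proved for simultaneous substitutions. If the substituted terms denote a
tuple of values `h` for the basis of a derivation `D`, then the substituted term denotes `h ≫ S.den
D`. A value for a ground or stable variable must be a coalgebra morphism out of the empty resource.
Such a map respects counit and comultiplication (`Res.coalg_counit`, `Res.coalg_comul`), which
settles weakening and contraction. Tuples of such maps are again coalgebra morphisms (`Vals.coalg`),
which lets them pass through the promotion in the rule for fixpoints. Numerals, promoted terms and
arbitrary terms of arrow type all qualify as values of their kind (`val_num`, `val_promote`,
`val_den`).

For the equations, soundness is applied to the given derivation of `M` with the substitution, and to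
an arbitrary derivation of the result with the identity substitution. Both sides denote the same
term in the environment of the basis, so uniqueness identifies them (`IsSub.den_eq`). Derivability
comes from the same denotation: `Sem.typ` rebuilds a derivation from it, using contraction wherever
two subterms share a variable. -/

theorem tensorμ_braiding {C : Type u} [Category.{v} C] [MonoidalCategory C] [SymmetricCategory C]
    (X₁ X₂ Y₁ Y₂ : C) :
    tensorμ X₁ X₂ Y₁ Y₂ ≫ (β_ (X₁ ⊗ Y₁) (X₂ ⊗ Y₂)).hom =
      ((β_ X₁ X₂).hom ⊗ₘ (β_ Y₁ Y₂).hom) ≫ tensorμ X₂ X₁ Y₂ Y₁ := by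
  simp [tensorμ, SymmetricCategory.braiding_swap_eq_inv_braiding Y₁ X₂,
    MonoidalCategory.tensorHom_def]

theorem tensorμ_whiskerLeft {C : Type u} [Category.{v} C] [MonoidalCategory C]
    [SymmetricCategory C] (X₁ Y₁ : C) {X₂ Y₂ X₂' Y₂' : C} (f : X₂ ⟶ X₂') (g : Y₂ ⟶ Y₂') :
    tensorμ X₁ X₂ Y₁ Y₂ ≫ ((X₁ ⊗ Y₁) ◁ (f ⊗ₘ g)) =
      (X₁ ◁ f ⊗ₘ Y₁ ◁ g) ≫ tensorμ X₁ X₂' Y₁ Y₂' := by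
  simpa using (tensorμ_natural (𝟙 X₁) f (𝟙 Y₁) g).symm

theorem tensorμ_whiskerRight {C : Type u} [Category.{v} C] [MonoidalCategory C]
    [SymmetricCategory C] {X₁ Y₁ X₁' Y₁' : C} (X₂ Y₂ : C) (f : X₁ ⟶ X₁') (g : Y₁ ⟶ Y₁') :
    tensorμ X₁ X₂ Y₁ Y₂ ≫ ((f ⊗ₘ g) ▷ (X₂ ⊗ Y₂)) =
      (f ▷ X₂ ⊗ₘ g ▷ Y₂) ≫ tensorμ X₁' X₂ Y₁' Y₂ := by
  simpa using (tensorμ_natural f (𝟙 X₂) g (𝟙 Y₂)).symm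

section

variable {L : Type u} [Category.{v} L] [MonoidalCategory L] [SymmetricCategory L]
  [MonoidalClosed L] [LinearCategory L]

theorem bang_map_comul {A B : L} (f : A ⟶ B) :
    (bang L).map f ≫ ComonObj.comul (X := (bang L).obj B) =
      ComonObj.comul (X := (bang L).obj A) ≫ ((bang L).map f ⊗ₘ (bang L).map f) :=
  LinearCategory.d_natural f

theorem bang_map_counit {A B : L} (f : A ⟶ B) :
    (bang L).map f ≫ ComonObj.counit (X := (bang L).obj B) =
      ComonObj.counit (X := (bang L).obj A) :=
  LinearCategory.e_natural f

/-- Coassociativity says that `δ` is a morphism of free coalgebras, so the last axiom of a linear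
category applies. This makes a stable variable an instance of `Res.ofCoalg`. -/
instance isComonHom_comult (A : L) :
    IsComonHom (M := (bang L).obj A) (N := (bang L).obj ((bang L).obj A)) ((bang L).δ.app A) :=
  LinearCategory.comonHom_of_coalg _ ((bang L).coassoc A).symm

variable (L)

/-- Resource-indexed objects: the objects `obj r` for resources `r`, with the maps that distribute
a resource over two subterms, discard the empty resource, and promote the empty resource. -/
structure Res where
  /-- the resources -/
  R : Type
  /-- the empty resource -/
  nil : R
  /-- `Split r r₁ r₂`: the resource `r` is the union of `r₁` and `r₂` -/
  Split : R → R → R → Prop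
  /-- the object of a resource -/
  obj : R → L
  split : ∀ {r r₁ r₂}, Split r r₁ r₂ → (obj r ⟶ obj r₁ ⊗ obj r₂)
  drop : obj nil ⟶ 𝟙_ L
  prom : obj nil ⟶ (bang L).obj (obj nil)
  split_unique : ∀ {r r' r₁ r₂}, Split r r₁ r₂ → Split r' r₁ r₂ → r = r'
  split_symm : ∀ {r r₁ r₂}, Split r r₁ r₂ → Split r r₂ r₁
  split_regroup : ∀ {r r₁ r₂ r₃ s}, Split r r₁ s → Split s r₂ r₃ →
    ∃ t, Split t r₁ r₂ ∧ Split r t r₃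
  split_nil : ∀ r, Split r r nil
  split_braiding : ∀ {r r₁ r₂} (h : Split r r₁ r₂),
    split h ≫ (β_ (obj r₁) (obj r₂)).hom = split (split_symm h)
  split_assoc : ∀ {r r₁ r₂ r₃ s t} (h : Split r r₁ s) (h' : Split s r₂ r₃) (k : Split t r₁ r₂)
    (k' : Split r t r₃),
    split h ≫ (obj r₁ ◁ split h') = split k' ≫ (split k ▷ obj r₃) ≫ (α_ _ _ _).hom
  split_drop : ∀ r, split (split_nil r) ≫ (obj r ◁ drop) = (ρ_ (obj r)).inv
  prom_ε : prom ≫ (bang L).ε.app (obj nil) = 𝟙 (obj nil)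
  prom_δ : prom ≫ (bang L).δ.app (obj nil) = prom ≫ (bang L).map prom
  prom_counit : prom ≫ ComonObj.counit = drop
  prom_comul : prom ≫ ComonObj.comul = split (split_nil nil) ≫ (prom ⊗ₘ prom)

variable {L}

/-- The duplicable resource given by a coalgebra with a compatible commutative comonoid. -/
def Res.ofCoalg (X : L) [ComonObj X] [IsCommComonObj X] (a : X ⟶ (bang L).obj X) [IsComonHom a]
    (h₁ : a ≫ (bang L).ε.app X = 𝟙 X) (h₂ : a ≫ (bang L).δ.app X = a ≫ (bang L).map a) :
    Res L where
  R := Unit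
  nil := ()
  Split _ _ _ := True
  obj _ := X
  split _ := ComonObj.comul
  drop := ComonObj.counit
  prom := a
  split_unique _ _ := rfl
  split_symm _ := trivial
  split_regroup _ _ := ⟨(), trivial, trivial⟩
  split_nil _ := trivial
  split_braiding _ := IsCommComonObj.comul_comm X
  split_assoc _ _ _ _ := ComonObj.comul_assoc X
  split_drop _ := ComonObj.comul_counit X
  prom_ε := h₁
  prom_δ := h₂
  prom_counit := IsComonHom.hom_counit a
  prom_comul := IsComonHom.hom_comul a

section Unit

theorem unit_ε : ε (bang L).toFunctor ≫ (bang L).ε.app (𝟙_ L) = 𝟙 (𝟙_ L) := by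
  simp

theorem unit_δ : ε (bang L).toFunctor ≫ (bang L).δ.app (𝟙_ L) =
    ε (bang L).toFunctor ≫ (bang L).map (ε (bang L).toFunctor) := by
  simp

theorem tensor_ε (A B : L) : μ (bang L).toFunctor A B ≫ (bang L).ε.app (A ⊗ B) =
    ((bang L).ε.app A ⊗ₘ (bang L).ε.app B) := by
  simp

theorem tensor_δ (A B : L) : μ (bang L).toFunctor A B ≫ (bang L).δ.app (A ⊗ B) =
    ((bang L).δ.app A ⊗ₘ (bang L).δ.app B) ≫ μ (bang L).toFunctor _ _ ≫
      (bang L).map (μ (bang L).toFunctor A B) := by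
  simp

/-- The trivial resource. -/
def Res.unit : Res L where
  R := Unit
  nil := ()
  Split _ _ _ := True
  obj _ := 𝟙_ L
  split _ := (λ_ (𝟙_ L)).inv
  drop := 𝟙 (𝟙_ L)
  prom := ε (bang L).toFunctor
  split_unique _ _ := rfl
  split_symm _ := trivial
  split_regroup _ _ := ⟨(), trivial, trivial⟩
  split_nil _ := trivial
  split_braiding _ := by simp [unitors_inv_equal]
  split_assoc _ _ _ _ := by monoidal_coherence
  split_drop _ := by simp [unitors_inv_equal]
  prom_ε := unit_ε
  prom_δ := unit_δ
  prom_counit := LinearCategory.e_unit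
  prom_comul := LinearCategory.d_unit

end Unit

/-- The object of a linear resource: present or absent. -/
def linObj (X : L) : Bool → L
  | true => X
  | false => 𝟙_ L

/-- Splitting a linear resource. -/
def linSplit (X : L) : (r r₁ r₂ : Bool) → r = (r₁ || r₂) ∧ (r₁ && r₂) = false →
    (linObj X r ⟶ linObj X r₁ ⊗ linObj X r₂)
  | true, true, false, _ => (ρ_ X).inv
  | true, false, true, _ => (λ_ X).inv
  | false, false, false, _ => (λ_ (𝟙_ L)).inv
  | false, true, _, h => by simp at h
  | _, true, true, h => by simp at h
  | true, false, false, h => by simp at h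
  | false, false, true, h => by simp at h

/-- The linear resource on an object. -/
def Res.lin (X : L) : Res L where
  R := Bool
  nil := false
  Split r r₁ r₂ := r = (r₁ || r₂) ∧ (r₁ && r₂) = false
  obj := linObj X
  split h := linSplit X _ _ _ h
  drop := 𝟙 (𝟙_ L)
  prom := ε (bang L).toFunctor
  split_unique h h' := h.1.trans h'.1.symm
  split_symm h := by rwa [Bool.or_comm, Bool.and_comm]
  split_regroup {r r₁ r₂ r₃ s} h h' := by
    refine ⟨r₁ || r₂, ?_⟩
    revert r r₁ r₂ r₃ s
    decide
  split_nil r := by simp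
  split_braiding {r r₁ r₂} h := by
    rcases r <;> rcases r₁ <;> rcases r₂ <;> simp at h <;>
      simp [linSplit, linObj, unitors_inv_equal]
  split_assoc {r r₁ r₂ r₃ s t} h h' k k' := by
    rcases r <;> rcases r₁ <;> rcases s <;> simp at h <;> rcases r₂ <;> rcases r₃ <;> simp at h' <;>
      rcases t <;> simp at k <;> simp at k' <;> simp only [linSplit, linObj] <;> monoidal_coherence
  split_drop r := by
    rcases r <;> simp [linSplit, linObj, unitors_inv_equal]
  prom_ε := unit_ε
  prom_δ := unit_δ
  prom_counit := LinearCategory.e_unit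
  prom_comul := LinearCategory.d_unit

/-- The tensor product of resources. -/
abbrev Res.tensor (A B : Res L) : Res L where
  R := A.R × B.R
  nil := (A.nil, B.nil)
  Split r r₁ r₂ := A.Split r.1 r₁.1 r₂.1 ∧ B.Split r.2 r₁.2 r₂.2
  obj r := A.obj r.1 ⊗ B.obj r.2
  split h := (A.split h.1 ⊗ₘ B.split h.2) ≫ tensorμ _ _ _ _
  drop := (A.drop ⊗ₘ B.drop) ≫ (λ_ (𝟙_ L)).hom
  prom := (A.prom ⊗ₘ B.prom) ≫ μ (bang L).toFunctor _ _
  split_unique h h' := Prod.ext (A.split_unique h.1 h'.1) (B.split_unique h.2 h'.2)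
  split_symm h := ⟨A.split_symm h.1, B.split_symm h.2⟩
  split_regroup h h' := by
    obtain ⟨t, h₁, h₂⟩ := A.split_regroup h.1 h'.1
    obtain ⟨s, h₃, h₄⟩ := B.split_regroup h.2 h'.2
    exact ⟨(t, s), ⟨h₁, h₃⟩, ⟨h₂, h₄⟩⟩
  split_nil r := ⟨A.split_nil r.1, B.split_nil r.2⟩
  split_braiding h := by
    rw [Category.assoc, tensorμ_braiding, tensorHom_comp_tensorHom_assoc, A.split_braiding,
      B.split_braiding]
  split_assoc h h' k k' := by
    have e₁ := A.split_assoc h.1 h'.1 k.1 k'.1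
    have e₂ := B.split_assoc h.2 h'.2 k.2 k'.2
    simp only [MonoidalCategory.whiskerLeft_comp, comp_whiskerRight, Category.assoc]
    rw [reassoc_of% tensorμ_whiskerLeft, reassoc_of% tensorμ_whiskerRight,
      tensorHom_comp_tensorHom_assoc,
      e₁, e₂, tensorHom_comp_tensorHom_assoc, associator_monoidal, tensorHom_comp_tensorHom_assoc]
    simp only [Category.assoc]
  split_drop r := by
    simp only [MonoidalCategory.whiskerLeft_comp, Category.assoc]
    rw [reassoc_of% tensorμ_whiskerLeft, tensorHom_comp_tensorHom_assoc, A.split_drop, B.split_drop,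
      ← cancel_mono (ρ_ _).hom, Iso.inv_hom_id, Category.assoc, Category.assoc,
      ← rightUnitor_monoidal, tensorHom_comp_tensorHom, Iso.inv_hom_id, Iso.inv_hom_id,
      id_tensorHom_id]
  prom_ε := by
    rw [Category.assoc, tensor_ε, tensorHom_comp_tensorHom, A.prom_ε, B.prom_ε, id_tensorHom_id]
  prom_δ := by
    rw [Category.assoc, tensor_δ, tensorHom_comp_tensorHom_assoc, A.prom_δ, B.prom_δ,
      Functor.map_comp, Category.assoc, ← μ_natural_assoc, tensorHom_comp_tensorHom_assoc]
  prom_counit := by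
    rw [Category.assoc, LinearCategory.e_tensor, tensorHom_comp_tensorHom_assoc, A.prom_counit,
      B.prom_counit]
  prom_comul := by
    rw [Category.assoc, LinearCategory.d_tensor, tensorHom_comp_tensorHom_assoc, A.prom_comul,
      B.prom_comul, ← tensorHom_comp_tensorHom_assoc, tensorμ_natural_assoc,
      tensorHom_comp_tensorHom]
    simp only [Category.assoc]

end

end

end SlLambda

/-! ### Maps between resources, and the coalgebra structure of the empty resource -/

namespace SlLambda

noncomputable section

open Functor.LaxMonoidal

section

variable {C : Type u} [Category.{v} C] [MonoidalCategory C] [SymmetricCategory C]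
  [MonoidalClosed C]

theorem comp_lcurry {X Y A B : C} (h : X ⟶ Y) (f : Y ⊗ A ⟶ B) :
    h ≫ lcurry f = lcurry ((h ▷ A) ≫ f) := by
  rw [lcurry, lcurry, ← MonoidalClosed.curry_natural_left,
    BraidedCategory.braiding_naturality_right_assoc]

theorem lcurry_leval {X Y A B : C} (f : X ⊗ A ⟶ B) (g : Y ⟶ A) :
    (lcurry f ⊗ₘ g) ≫ leval A B = (X ◁ g) ≫ f := by
  rw [leval, BraidedCategory.braiding_naturality_assoc, lcurry, MonoidalCategory.tensorHom_def,
    Category.assoc, MonoidalClosed.whiskerLeft_curry_ihom_ev_app,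
    ← BraidedCategory.braiding_naturality_right_assoc, SymmetricCategory.symmetry_assoc]

end

variable {L : Type u} [Category.{v} L] [MonoidalCategory L] [SymmetricCategory L]
  [MonoidalClosed L] [LinearCategory L]

namespace Res

/-- `drop`, at a resource equal to the empty one. -/
def dropAt (A : Res L) {r : A.R} (h : r = A.nil) : A.obj r ⟶ 𝟙_ L :=
  eqToHom (congrArg A.obj h) ≫ A.drop

/-- `prom`, at a resource equal to the empty one. -/
def promAt (A : Res L) {r : A.R} (h : r = A.nil) : A.obj r ⟶ (bang L).obj (A.obj r) :=
  eqToHom (congrArg A.obj h) ≫ A.prom ≫ (bang L).map (eqToHom (congrArg A.obj h.symm))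

@[simp] theorem dropAt_rfl (A : Res L) (h : A.nil = A.nil) : A.dropAt h = A.drop := by
  simp [dropAt]

@[simp] theorem promAt_rfl (A : Res L) (h : A.nil = A.nil) : A.promAt h = A.prom := by
  simp [promAt]

theorem drop_split (A : Res L) {r : A.R} (h : A.Split r A.nil r) :
    A.split h ≫ (A.drop ▷ A.obj r) = (λ_ (A.obj r)).inv := by
  rw [← A.split_braiding (A.split_nil r), Category.assoc,
    ← BraidedCategory.braiding_naturality_right, reassoc_of% A.split_drop, rightUnitor_inv_braiding]

theorem split_drop' (A : Res L) {r : A.R} (h : A.Split r r A.nil) :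
    A.split h ≫ (A.obj r ◁ A.drop) = (ρ_ (A.obj r)).inv := A.split_drop r

theorem eq_of_split_nil (A : Res L) {r s : A.R} (h : A.Split r s A.nil) : r = s :=
  A.split_unique h (A.split_nil s)

end Res

/-- A map of resource-indexed objects. -/
structure ResHom (A B : Res L) where
  R : B.R → A.R
  hom : ∀ r, A.obj (R r) ⟶ B.obj r
  R_nil : R B.nil = A.nil
  R_split : ∀ {r r₁ r₂}, B.Split r r₁ r₂ → A.Split (R r) (R r₁) (R r₂)
  hom_split : ∀ {r r₁ r₂} (h : B.Split r r₁ r₂),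
    hom r ≫ B.split h = A.split (R_split h) ≫ (hom r₁ ⊗ₘ hom r₂)
  hom_drop : hom B.nil ≫ B.drop = A.dropAt R_nil
  hom_prom : hom B.nil ≫ B.prom = A.promAt R_nil ≫ (bang L).map (hom B.nil)

/-- The counit `e` is a coalgebra morphism; precomposing that axiom with `prom`, which is compatible
with `δ` and with the counits, transfers it to the empty resource. -/
theorem Res.prom_map_drop (A : Res L) :
    A.prom ≫ (bang L).map A.drop = A.drop ≫ ε (bang L).toFunctor := by
  have h := LinearCategory.e_coalg (A.obj A.nil)
  have h' := A.prom ≫= h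
  change A.prom ≫ (bang L).δ.app _ ≫ (bang L).map _ = _ at h'
  rw [reassoc_of% A.prom_δ, ← Functor.map_comp, A.prom_counit, reassoc_of% A.prom_counit] at h'
  exact h'

theorem Res.split_drop_drop (A : Res L) (h : A.Split A.nil A.nil A.nil) :
    A.split h ≫ (A.drop ⊗ₘ A.drop) ≫ (λ_ (𝟙_ L)).hom = A.drop := by
  rw [MonoidalCategory.tensorHom_def'_assoc, reassoc_of% (A.split_drop' h), unitors_equal,
    rightUnitor_naturality, Iso.inv_hom_id_assoc]

section

variable {C : Type u} [Category.{v} C] [MonoidalCategory C] [SymmetricCategory C]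

theorem tensorμ_rightUnitor (X₁ X₂ : C) :
    tensorμ X₁ X₂ (𝟙_ C) (𝟙_ C) ≫ ((ρ_ X₁).hom ⊗ₘ (ρ_ X₂).hom) =
      ((X₁ ⊗ X₂) ◁ (λ_ (𝟙_ C)).hom) ≫ (ρ_ (X₁ ⊗ X₂)).hom := by
  rw [tensor_right_unitality, whiskerLeft_hom_inv_assoc]

theorem tensorμ_leftUnitor (X₁ X₂ : C) :
    tensorμ (𝟙_ C) (𝟙_ C) X₁ X₂ ≫ ((λ_ X₁).hom ⊗ₘ (λ_ X₂).hom) =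
      ((λ_ (𝟙_ C)).hom ▷ (X₁ ⊗ X₂)) ≫ (λ_ (X₁ ⊗ X₂)).hom := by
  rw [tensor_left_unitality, hom_inv_whiskerRight_assoc]

theorem drop_right_split {X X₁ X₂ Y Y₁ Y₂ : C} (s : X ⟶ X₁ ⊗ X₂) (t : Y ⟶ Y₁ ⊗ Y₂)
    (d : Y ⟶ 𝟙_ C) (d₁ : Y₁ ⟶ 𝟙_ C) (d₂ : Y₂ ⟶ 𝟙_ C)
    (h : t ≫ (d₁ ⊗ₘ d₂) ≫ (λ_ (𝟙_ C)).hom = d) :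
    ((X ◁ d) ≫ (ρ_ X).hom) ≫ s = ((s ⊗ₘ t) ≫ tensorμ X₁ X₂ Y₁ Y₂) ≫
      ((X₁ ◁ d₁) ≫ (ρ_ X₁).hom ⊗ₘ (X₂ ◁ d₂) ≫ (ρ_ X₂).hom) := by
  rw [Category.assoc, Category.assoc, ← tensorHom_comp_tensorHom, ← tensorμ_natural_right_assoc,
    tensorμ_rightUnitor, MonoidalCategory.tensorHom_def_assoc,
    ← MonoidalCategory.whiskerLeft_comp_assoc, ← MonoidalCategory.whiskerLeft_comp_assoc,
    Category.assoc, h, ← whisker_exchange_assoc, rightUnitor_naturality]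

theorem drop_left_split {X X₁ X₂ Y Y₁ Y₂ : C} (s : X ⟶ X₁ ⊗ X₂) (t : Y ⟶ Y₁ ⊗ Y₂)
    (d : Y ⟶ 𝟙_ C) (d₁ : Y₁ ⟶ 𝟙_ C) (d₂ : Y₂ ⟶ 𝟙_ C)
    (h : t ≫ (d₁ ⊗ₘ d₂) ≫ (λ_ (𝟙_ C)).hom = d) :
    ((d ▷ X) ≫ (λ_ X).hom) ≫ s = ((t ⊗ₘ s) ≫ tensorμ Y₁ Y₂ X₁ X₂) ≫
      ((d₁ ▷ X₁) ≫ (λ_ X₁).hom ⊗ₘ (d₂ ▷ X₂) ≫ (λ_ X₂).hom) := by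
  rw [Category.assoc, Category.assoc, ← tensorHom_comp_tensorHom, ← tensorμ_natural_left_assoc,
    tensorμ_leftUnitor, MonoidalCategory.tensorHom_def'_assoc,
    ← comp_whiskerRight_assoc, ← comp_whiskerRight_assoc,
    Category.assoc, h, whisker_exchange_assoc, leftUnitor_naturality]

end

theorem Res.dropAt_tensor (A X : Res L) {a : A.R} (e : a = A.nil)
    (e' : (a, X.nil) = (A.tensor X).nil) :
    (A.tensor X).dropAt e' = (A.dropAt e ⊗ₘ X.drop) ≫ (λ_ (𝟙_ L)).hom := by
  subst e
  simp

theorem Res.promAt_tensor (A X : Res L) {a : A.R} (e : a = A.nil)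
    (e' : (a, X.nil) = (A.tensor X).nil) :
    (A.tensor X).promAt e' = (A.promAt e ⊗ₘ X.prom) ≫ μ (bang L).toFunctor _ _ := by
  subst e
  simp

/-- The projection that discards the second resource. -/
def ResHom.fst (A B : Res L) : ResHom (A.tensor B) A where
  R r := (r, B.nil)
  hom r := (A.obj r ◁ B.drop) ≫ (ρ_ _).hom
  R_nil := rfl
  R_split h := ⟨h, B.split_nil B.nil⟩
  hom_split h := drop_right_split _ _ _ _ _ (B.split_drop_drop _)
  hom_drop := by
    simp [MonoidalCategory.tensorHom_def', unitors_equal]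
  hom_prom := by
    rw [Res.promAt_rfl, Functor.map_comp, Category.assoc, Category.assoc, ← μ_natural_right_assoc,
      MonoidalCategory.tensorHom_def_assoc, ← MonoidalCategory.whiskerLeft_comp_assoc,
      Res.prom_map_drop, MonoidalCategory.whiskerLeft_comp_assoc,
      ← Functor.LaxMonoidal.right_unitality, ← whisker_exchange_assoc,
      rightUnitor_naturality]

/-- The projection that discards the first resource. -/
def ResHom.snd (A B : Res L) : ResHom (A.tensor B) B where
  R r := (A.nil, r)
  hom r := (A.drop ▷ B.obj r) ≫ (λ_ _).hom
  R_nil := rfl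
  R_split h := ⟨A.split_nil A.nil, h⟩
  hom_split h := drop_left_split _ _ _ _ _ (A.split_drop_drop _)
  hom_drop := by
    simp [MonoidalCategory.tensorHom_def]
  hom_prom := by
    rw [Res.promAt_rfl, Functor.map_comp, Category.assoc, Category.assoc, ← μ_natural_left_assoc,
      MonoidalCategory.tensorHom_def'_assoc, ← comp_whiskerRight_assoc,
      Res.prom_map_drop, comp_whiskerRight_assoc,
      ← Functor.LaxMonoidal.left_unitality, whisker_exchange_assoc,
      leftUnitor_naturality]

/-- Tensoring with a resource. -/
def ResHom.whiskerRight {A B : Res L} (f : ResHom A B) (X : Res L) :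
    ResHom (A.tensor X) (B.tensor X) where
  R r := (f.R r.1, r.2)
  hom r := f.hom r.1 ▷ X.obj r.2
  R_nil := Prod.ext f.R_nil rfl
  R_split h := ⟨f.R_split h.1, h.2⟩
  hom_split h := by
    rw [Category.assoc, ← tensorHom_id, ← tensorHom_id, ← tensorHom_id, ← tensorμ_natural,
      tensorHom_comp_tensorHom_assoc, tensorHom_comp_tensorHom_assoc, f.hom_split h.1]
    simp
  hom_drop := by
    rw [Res.dropAt_tensor _ _ f.R_nil, ← f.hom_drop, ← tensorHom_id,
      tensorHom_comp_tensorHom_assoc, Category.id_comp]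
  hom_prom := by
    rw [Res.promAt_tensor _ _ f.R_nil, Category.assoc, ← μ_natural_left, ← tensorHom_id,
      ← tensorHom_id, tensorHom_comp_tensorHom_assoc, tensorHom_comp_tensorHom_assoc, f.hom_prom]
    simp

theorem ResHom.whiskerRight_drop {A B : Res L} (f : ResHom A B) {X Y : L} (g : X ⟶ Y) :
    (f.hom B.nil ▷ X) ≫ (B.drop ⊗ₘ g) ≫ (λ_ Y).hom = (A.dropAt f.R_nil ⊗ₘ g) ≫ (λ_ Y).hom := by
  rw [← tensorHom_id, tensorHom_comp_tensorHom_assoc, Category.id_comp, f.hom_drop]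

theorem ResHom.hom_promAt {A B : Res L} (f : ResHom A B) {r : B.R} (e : r = B.nil) :
    f.hom r ≫ B.promAt e = A.promAt ((congrArg f.R e).trans f.R_nil) ≫
      (bang L).map (f.hom r) := by
  subst e
  rw [Res.promAt_rfl, f.hom_prom]

/-- Each factor is split against its own empty resource, and the projections drop exactly that part,
so only counit laws are involved. With this, values built separately on the two factors can be
recombined into a plain tensor product. -/
theorem Res.split_fst_snd (A B : Res L) {r : A.R} {b : B.R}
    (h : (A.tensor B).Split (r, b) (r, B.nil) (A.nil, b)) :
    (A.tensor B).split h ≫ ((ResHom.fst A B).hom r ⊗ₘ (ResHom.snd A B).hom b) =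
      𝟙 (A.obj r ⊗ B.obj b) := by
  -- The only braiding in this interchange is that of the unit with itself, so coherence for unitors
  -- and associators suffices.
  have e : tensorμ (A.obj r) (𝟙_ L) (𝟙_ L) (B.obj b) ≫ ((ρ_ _).hom ⊗ₘ (λ_ _).hom) =
      ((ρ_ _).hom ⊗ₘ (λ_ _).hom) := by
    simp only [tensorμ, braiding_tensorUnit_left]
    monoidal_coherence
  have e₁ := A.split_drop' h.1
  have e₂ := B.drop_split h.2
  rw [← id_tensorHom] at e₁
  rw [← tensorHom_id] at e₂
  simp only [ResHom.fst, ResHom.snd]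
  rw [← id_tensorHom, ← tensorHom_id, ← tensorHom_comp_tensorHom, Category.assoc,
    ← tensorμ_natural_assoc, e, tensorHom_comp_tensorHom_assoc, e₁, e₂, tensorHom_comp_tensorHom]
  simp

/-- A map from the empty resource that is a coalgebra morphism is a comonoid morphism. -/
theorem Res.coalg_counit (A : Res L) {X : L} [ComonObj X] {a : X ⟶ (bang L).obj X} [IsComonHom a]
    {g : A.obj A.nil ⟶ X} (hg : g ≫ a = A.prom ≫ (bang L).map g) :
    g ≫ ComonObj.counit = A.drop := by
  rw [← IsComonHom.hom_counit a, reassoc_of% hg, bang_map_counit, A.prom_counit]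

/-- As `a` is a comonoid morphism with retraction `ε`, the comultiplication of `X` is recovered from
that of `!X`. There `g` becomes `!g` after `prom`, and naturality of `d` applies. -/
theorem Res.coalg_comul (A : Res L) {X : L} [ComonObj X] {a : X ⟶ (bang L).obj X} [IsComonHom a]
    (ha : a ≫ (bang L).ε.app X = 𝟙 X)
    {g : A.obj A.nil ⟶ X} (hg : g ≫ a = A.prom ≫ (bang L).map g) :
    g ≫ ComonObj.comul = A.split (A.split_nil _) ≫ (g ⊗ₘ g) := by
  have e : ComonObj.comul (X := X) =
      a ≫ ComonObj.comul ≫ ((bang L).ε.app X ⊗ₘ (bang L).ε.app X) := by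
    rw [IsComonHom.hom_comul_assoc, tensorHom_comp_tensorHom, ha, id_tensorHom_id, Category.comp_id]
  rw [e, reassoc_of% hg, reassoc_of% bang_map_comul, reassoc_of% A.prom_comul,
    tensorHom_comp_tensorHom,
    tensorHom_comp_tensorHom, Comonad.counit_naturality, reassoc_of% A.prom_ε]

theorem tensor_whisker_μ {X Y X' Y' Z : L} (a : X ⟶ (bang L).obj X') (p : Y ⟶ Z)
    (q : Z ⟶ (bang L).obj Y') :
    (a ⊗ₘ p) ≫ ((bang L).obj X' ◁ q) ≫ μ (bang L).toFunctor X' Y' =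
      (a ⊗ₘ p ≫ q) ≫ μ (bang L).toFunctor X' Y' := by
  rw [← id_tensorHom, tensorHom_comp_tensorHom_assoc, Category.comp_id]

/-- The padding with identities is the form that `promAt` takes at a reflexive equation, where both
transports are identities. -/
theorem id_coalg {X : L} (a : X ⟶ (bang L).obj X) :
    𝟙 X ≫ a = (𝟙 X ≫ a ≫ (bang L).map (𝟙 X)) ≫ (bang L).map (𝟙 X) := by
  simp

/-- Splitting the empty resource equals `prom`, then `d`, then `ε ⊗ ε`. By `prom_δ` a second
promotion is a `δ`, so the axiom that `d` is a coalgebra morphism can be used, and the counits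
cancel the resulting copies of `δ`. -/
theorem Res.prom_map_split (A : Res L) :
    A.prom ≫ (bang L).map (A.split (A.split_nil A.nil)) =
      A.split (A.split_nil A.nil) ≫ (A.prom ⊗ₘ A.prom) ≫ μ (bang L).toFunctor _ _ := by
  have e : A.split (A.split_nil A.nil) = A.prom ≫ ComonObj.comul ≫
      ((bang L).ε.app _ ⊗ₘ (bang L).ε.app _) := by
    rw [reassoc_of% A.prom_comul, tensorHom_comp_tensorHom, A.prom_ε, id_tensorHom_id,
      Category.comp_id]
  have h := LinearCategory.d_coalg (A.obj A.nil)
  conv_lhs => rw [e, Functor.map_comp, Functor.map_comp, ← reassoc_of% A.prom_δ]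
  rw [← reassoc_of% A.prom_comul, reassoc_of% h, ← μ_natural, tensorHom_comp_tensorHom_assoc,
    (bang L).right_counit, id_tensorHom_id, Category.id_comp]
  rfl

namespace Res

variable (A : Res L)

theorem split_regroup' {r r₁ r₂ r₃ t : A.R} (h : A.Split r t r₃) (h' : A.Split t r₁ r₂) :
    ∃ s, A.Split r r₁ s ∧ A.Split s r₂ r₃ := by
  obtain ⟨s, h₁, h₂⟩ := A.split_regroup (A.split_symm h) (A.split_symm h')
  exact ⟨s, A.split_symm h₂, A.split_symm h₁⟩

theorem drop_split_tensor {r : A.R} (h : A.Split r A.nil r) {X Y : L} (f : 𝟙_ L ⟶ X)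
    (g : A.obj r ⟶ Y) : A.split h ≫ (A.drop ≫ f ⊗ₘ g) = g ≫ (λ_ Y).inv ≫ (f ▷ Y) := by
  rw [← Category.comp_id g, ← tensorHom_comp_tensorHom, MonoidalCategory.tensorHom_def_assoc,
    reassoc_of% (A.drop_split h), tensorHom_id, leftUnitor_inv_naturality_assoc, Category.comp_id]

theorem split_drop_tensor {r : A.R} (h : A.Split r r A.nil) {X Y : L} (f : 𝟙_ L ⟶ X)
    (g : A.obj r ⟶ Y) : A.split h ≫ (g ⊗ₘ A.drop ≫ f) = g ≫ (ρ_ Y).inv ≫ (Y ◁ f) := by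
  rw [← Category.comp_id g, ← tensorHom_comp_tensorHom, MonoidalCategory.tensorHom_def'_assoc,
    reassoc_of% (A.split_drop' h), id_tensorHom, rightUnitor_inv_naturality_assoc,
    Category.comp_id]

theorem split_assoc_tensor {r r₁ r₂ r₃ s t : A.R} (h : A.Split r r₁ s) (h' : A.Split s r₂ r₃)
    (k : A.Split t r₁ r₂) (k' : A.Split r t r₃) {X Y Z : L} (f : A.obj r₁ ⟶ X) (g : A.obj r₂ ⟶ Y)
    (i : A.obj r₃ ⟶ Z) :
    A.split h ≫ (f ⊗ₘ A.split h' ≫ (g ⊗ₘ i)) =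
      A.split k' ≫ (A.split k ≫ (f ⊗ₘ g) ⊗ₘ i) ≫ (α_ X Y Z).hom := by
  have e₁ : (f ⊗ₘ A.split h' ≫ (g ⊗ₘ i)) = (A.obj r₁ ◁ A.split h') ≫ (f ⊗ₘ g ⊗ₘ i) := by
    rw [← id_tensorHom, tensorHom_comp_tensorHom, Category.id_comp]
  have e₂ : (A.split k ≫ (f ⊗ₘ g) ⊗ₘ i) = (A.split k ▷ A.obj r₃) ≫ ((f ⊗ₘ g) ⊗ₘ i) := by
    rw [← tensorHom_id, tensorHom_comp_tensorHom, Category.id_comp]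
  rw [e₁, e₂, reassoc_of% (A.split_assoc h h' k k'), Category.assoc, associator_naturality]

end Res

end

end SlLambda

namespace SlLambda

/-! ### Terms -/

/-- The type of a variable. -/
def Var.ty : Var → Ty
  | .var σ _ => σ
  | .svar σ _ => σ

namespace Term

/-- Replace every free variable `y` below `d` binders by `s d y`. -/
def trav (s : ℕ → Var → Term) : ℕ → Term → Term
  | _, zero => zero
  | _, succ => succ
  | _, pred => pred
  | d, lif M P Q => lif (trav s d M) (trav s d P) (trav s d Q)
  | d, app M N => app (trav s d M) (trav s d N)
  | d, fvar y => s d y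
  | _, bvar j => bvar j
  | d, lam σ M => lam σ (trav s (d + 1) M)
  | d, mu σ M => mu σ (trav s (d + 1) M)

/-- All bound variables of the term below `k` binders are bound. -/
def LC : ℕ → Term → Prop
  | k, lif M P Q => LC k M ∧ LC k P ∧ LC k Q
  | k, app M N => LC k M ∧ LC k N
  | k, bvar j => j < k
  | k, lam _ M => LC (k + 1) M
  | k, mu _ M => LC (k + 1) M
  | _, _ => True

theorem trav_fvar (M : Term) : ∀ d, trav (fun _ y => fvar y) d M = M := by
  induction M <;> intro d <;> simp_all [trav]

theorem trav_subst (x : Var) (N M : Term) :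
    ∀ d, trav (fun _ y => if y = x then N else fvar y) d M = M.subst x N := by
  induction M <;> intro d <;> simp_all [trav, subst]

theorem trav_of_subst (s : ℕ → Var → Term) (x z : Var) (M : Term) :
    ∀ d, trav s d (M.subst x (fvar z)) = trav (fun d y => if y = x then s d z else s d y) d M := by
  induction M <;> intro d <;> simp_all [trav, subst]
  split_ifs <;> simp [trav]

/-- Under contraction a substitution becomes one that sends both merged variables to the same term.
This is why soundness needs simultaneous substitutions. -/
theorem trav_merge (s : ℕ → Var → Term) (z x₁ x₂ : Var) (M : Term) (d : ℕ) :
    trav s d (M.merge z x₁ x₂) =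
      trav (fun d y => if y = x₁ ∨ y = x₂ then s d z else s d y) d M := by
  rw [merge, trav_of_subst, trav_of_subst]
  congr 1
  funext d y
  split_ifs <;> simp_all

/-- Extend a substitution under a binder of `x`. -/
def push (s : ℕ → Var → Term) (x : Var) (d : ℕ) (y : Var) : Term :=
  if y = x then bvar d else s (d + 1) y

/-- Closing only replaces a name by an index, hence it can be absorbed into the substitution. The
binder cases of soundness thus reduce to the substitution `push s x`. -/
theorem trav_close (s : ℕ → Var → Term) (x : Var) (M : Term) :
    ∀ d, LC d M → trav s (d + 1) (close x d M) = trav (push s x) d M := by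
  induction M <;> intro d h <;> simp_all [trav, close, LC, push]
  split_ifs <;> simp_all [trav]

theorem LC.subst {x z : Var} {M : Term} : ∀ {k}, LC k M → LC k (M.subst x (fvar z)) := by
  induction M <;> intro k h <;> simp_all [LC, Term.subst]
  split_ifs <;> simp [LC]

theorem LC.close {x : Var} {M : Term} : ∀ {k}, LC k M → LC (k + 1) (close x k M) := by
  induction M <;> intro k h <;> simp_all [LC, Term.close]
  · split_ifs <;> simp [LC]
  · omega

theorem LC.num (n k : ℕ) : LC k (num n) := by
  induction n <;> simp_all [LC, Term.num]

end Term

theorem Deriv.lc {Γ : Basis} {M : Term} {τ : Ty} (D : Deriv Γ M τ) : Term.LC 0 M := by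
  induction D with
  | lif _ _ _ _ h₁ h₂ h₃ => exact ⟨h₁, h₂, h₃⟩
  | ap _ _ _ h₁ h₂ => exact ⟨h₁, h₂⟩
  | ex _ h => exact h
  | gw _ _ _ h => exact h
  | sw _ _ _ h => exact h
  | gc _ _ _ _ _ h => exact h.subst.subst
  | sc _ _ _ _ _ h => exact h.subst.subst
  | lam _ _ h => exact h.close
  | mu _ _ _ _ h => exact h.close
  | _ => trivial

theorem Deriv.nodup {Γ : Basis} {M : Term} {τ : Ty} (D : Deriv Γ M τ) : Γ.Nodup := by
  induction D with
  | lif h _ _ _ h₁ h₂ h₃ => exact List.nodup_append'.2 ⟨h₁, h₂, h⟩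
  | ap h _ _ h₁ h₂ => exact List.nodup_append'.2 ⟨h₁, h₂, h⟩
  | ex _ h => exact ((List.Perm.swap _ _ _).append_left _).nodup h
  | gw _ h _ h' => exact List.nodup_append'.2 ⟨h', by simp, by simpa using h⟩
  | sw _ h _ h' => exact List.nodup_append'.2 ⟨h', by simp, by simpa using h⟩
  | gc _ _ _ h _ h' =>
    exact List.nodup_append'.2 ⟨(List.nodup_append'.1 h').1, by simp, by simpa using h⟩
  | sc _ _ _ h _ h' =>
    exact List.nodup_append'.2 ⟨(List.nodup_append'.1 h').1, by simp, by simpa using h⟩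
  | lam _ _ h => exact (List.nodup_append'.1 h).1
  | mu _ _ _ _ h => exact (List.nodup_append'.1 h).1
  | _ => simp

noncomputable section

open Functor.LaxMonoidal

variable {L : Type u} [Category.{v} L] [MonoidalCategory L] [SymmetricCategory L]
  [MonoidalClosed L] [LinearCategory L] [HasFiniteProducts L]

/-! ### Environments and the syntax-directed denotation of terms -/

namespace SlCategory

variable (S : SlCategory L)

instance : IsComonHom S.N.a := S.p_comon

/-- The resource of an ordinary variable. -/
def ores : Ty → Res L
  | .iota => .ofCoalg S.N.A S.N.a S.N.counit S.N.coassoc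
  | .arr σ τ => .lin (S.ty (.arr σ τ))

/-- The resource of a variable. -/
def vres : Var → Res L
  | .var σ _ => S.ores σ
  | .svar σ _ => .ofCoalg ((bang L).obj (S.ty σ)) ((bang L).δ.app (S.ty σ))
      ((bang L).left_counit _) ((bang L).coassoc _).symm

/-- The full resource of an ordinary variable. -/
def oone : (σ : Ty) → (S.ores σ).R
  | .iota => ()
  | .arr _ _ => true

/-- The full resource of a variable. -/
def vone : (x : Var) → (S.vres x).R
  | .var σ _ => S.oone σ
  | .svar _ _ => ()

/-- The object of the full resource of an ordinary variable. -/
def oiso : (σ : Ty) → ((S.ores σ).obj (S.oone σ) ≅ S.ty σ)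
  | .iota => Iso.refl S.N.A
  | .arr σ τ => Iso.refl (S.ty (.arr σ τ))

/-- The object of the full resource of a variable. -/
def viso : (x : Var) → ((S.vres x).obj (S.vone x) ≅ S.var x)
  | .var σ _ => S.oiso σ
  | .svar σ _ => Iso.refl ((bang L).obj (S.ty σ))

/-- The value of a variable. -/
def vev : (x : Var) → (S.var x ⟶ S.ty x.ty)
  | .var σ _ => 𝟙 (S.ty σ)
  | .svar σ _ => (bang L).ε.app (S.ty σ)

/-- The denotation of `0`. -/
def zeroMor : 𝟙_ L ⟶ S.ty .iota := S.zero

/-- The denotation of `succ`. -/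
def succMor : 𝟙_ L ⟶ S.ty (.arr .iota .iota) := lcurry ((λ_ S.N.A).hom ≫ S.succ)

/-- The denotation of `pred`. -/
def predMor : 𝟙_ L ⟶ S.ty (.arr .iota .iota) := lcurry ((λ_ S.N.A).hom ≫ S.pred)

/-- Application. -/
def apMor (σ τ : Ty) : S.ty (.arr σ τ) ⊗ S.ty σ ⟶ S.ty τ := leval (S.ty σ) (S.ty τ)

/-- The conditional. -/
def lifMor : S.ty .iota ⊗ (S.ty .iota ⨯ S.ty .iota) ⟶ S.ty .iota := S.lif

/-- Abstraction. -/
def lamMor {X : L} {σ τ : Ty} (f : X ⊗ S.var (.var σ 0) ⟶ S.ty τ) : X ⟶ S.ty (.arr σ τ) :=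
  lcurry (A := S.ty σ) f

/-- The fixpoint of a map with respect to a promotion of its parameters. -/
def muMor {X : L} {σ : Ty} (p : X ⟶ (bang L).obj X) (f : X ⊗ S.var (.svar σ 0) ⟶ S.ty σ) :
    X ⟶ S.ty σ :=
  p ≫ (bang L).map (lcurry (A := (bang L).obj (S.ty σ)) f) ≫ S.fix (S.ty σ)

variable {S} in
theorem comp_lamMor {X Y : L} {σ τ : Ty} (h : X ⟶ Y) (f : Y ⊗ S.var (.var σ 0) ⟶ S.ty τ) :
    h ≫ S.lamMor f = S.lamMor ((h ▷ _) ≫ f) := comp_lcurry _ _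

variable {S} in
-- A coalgebra morphism `h` can be carried inside `!`, where currying absorbs it. This is the only
-- way in which a map slides under a fixpoint.
theorem comp_muMor {X Y : L} {σ : Ty} (h : X ⟶ Y) {p : X ⟶ (bang L).obj X}
    {q : Y ⟶ (bang L).obj Y} (f : Y ⊗ S.var (.svar σ 0) ⟶ S.ty σ)
    (e : h ≫ q = p ≫ (bang L).map h) :
    h ≫ S.muMor q f = S.muMor p ((h ▷ _) ≫ f) := by
  rw [muMor, reassoc_of% e, ← Functor.map_comp_assoc]
  exact congrArg (fun t => p ≫ (bang L).map t ≫ S.fix (S.ty σ))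
    (comp_lcurry (A := (bang L).obj (S.ty σ)) h f)

/-- A resource-indexed object with values for free and bound variables. -/
structure Env extends Res L where
  val : Var ⊕ ℕ → (τ : Ty) → (r : R) → (obj r ⟶ S.ty τ) → Prop

variable {S}

namespace Env

/-- The values of a tensor product of environments. -/
inductive PairVal (A B : Env S) (a : Var ⊕ ℕ) :
    (τ : Ty) → (r : (A.toRes.tensor B.toRes).R) → ((A.toRes.tensor B.toRes).obj r ⟶ S.ty τ) → Prop
  | left {τ r g} (h : A.val a τ r g) : PairVal A B a τ (r, B.nil) ((g ⊗ₘ B.drop) ≫ (ρ_ _).hom)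
  | right {τ r g} (h : B.val a τ r g) : PairVal A B a τ (A.nil, r) ((A.drop ⊗ₘ g) ≫ (λ_ _).hom)

/-- The tensor product of environments. -/
abbrev tensor (A B : Env S) : Env S where
  toRes := A.toRes.tensor B.toRes
  val := PairVal A B

/-- The values of a single variable. -/
inductive SlotVal (S : SlCategory L) (a : Var ⊕ ℕ) (x : Var) :
    Var ⊕ ℕ → (τ : Ty) → (r : (S.vres x).R) → ((S.vres x).obj r ⟶ S.ty τ) → Prop
  | mk : SlotVal S a x a x.ty (S.vone x) ((S.viso x).hom ≫ S.vev x)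

/-- The environment of a single variable `x`, referred to by `a`. -/
abbrev slot (S : SlCategory L) (a : Var ⊕ ℕ) (x : Var) : Env S where
  toRes := S.vres x
  val := SlotVal S a x

/-- Shift the bound variables by one. -/
abbrev shift (A : Env S) : Env S where
  toRes := A.toRes
  val
    | .inl y => A.val (.inl y)
    | .inr 0 => fun _ _ _ => False
    | .inr (j + 1) => A.val (.inr j)

/-- Extend an environment by a bound variable. -/
abbrev ext (A : Env S) (x : Var) : Env S := A.shift.tensor (slot S (.inr 0) x)

/-- The environment of a basis. -/
def ofCtx (S : SlCategory L) : Basis → Env S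
  | [] => { Res.unit with val := fun _ _ _ _ => False }
  | x :: Γ => (slot S (.inl x) x).tensor (ofCtx S Γ)

end Env

/-- `Sem A r M τ g`: in the environment `A`, the term `M` uses the resource `r`, has type `τ`, and
denotes `g`. -/
inductive Sem : (A : Env S) → (r : A.R) → Term → (τ : Ty) → (A.obj r ⟶ S.ty τ) → Prop
  | zero {A} : Sem A A.nil .zero .iota (A.drop ≫ S.zeroMor)
  | succ {A} : Sem A A.nil .succ (.arr .iota .iota) (A.drop ≫ S.succMor)
  | pred {A} : Sem A A.nil .pred (.arr .iota .iota) (A.drop ≫ S.predMor)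
  | fvar {A y τ r g} (h : A.val (.inl y) τ r g) : Sem A r (.fvar y) τ g
  | bvar {A j τ r g} (h : A.val (.inr j) τ r g) : Sem A r (.bvar j) τ g
  | app {A r r₁ r₂ M N σ τ f g} (h : A.Split r r₁ r₂) (h₁ : Sem A r₁ M (.arr σ τ) f)
      (h₂ : Sem A r₂ N σ g) :
      Sem A r (.app M N) τ (A.split h ≫ (f ⊗ₘ g) ≫ S.apMor σ τ)
  | lif {A r r₁ r₂ M P Q f g₁ g₂} (h : A.Split r r₁ r₂) (h₁ : Sem A r₁ M .iota f)
      (h₂ : Sem A r₂ P .iota g₁) (h₃ : Sem A r₂ Q .iota g₂) :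
      Sem A r (.lif M P Q) .iota (A.split h ≫ (f ⊗ₘ prod.lift g₁ g₂) ≫ S.lifMor)
  | lam {A r σ τ M f} (h : Sem (A.ext (.var σ 0)) (r, S.vone (.var σ 0)) M τ f) :
      Sem A r (.lam σ M) (.arr σ τ) (S.lamMor ((A.obj r ◁ (S.viso (.var σ 0)).inv) ≫ f))
  -- Fixpoints exist only at the empty resource, the one that can be promoted. This mirrors the
  -- restriction of the rule to bases of ground and stable variables.
  | mu {A σ M f} (h : Sem (A.ext (.svar σ 0)) (A.nil, S.vone (.svar σ 0)) M σ f) :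
      Sem A A.nil (.mu σ M) σ (S.muMor A.prom ((A.obj A.nil ◁ (S.viso (.svar σ 0)).inv) ≫ f))

end SlCategory

/-! ### Change of environment and uniqueness of denotations -/

namespace SlCategory

variable {S : SlCategory L}

/-- A map of environments preserves the values of free variables and of the first `k` bound
variables. -/
structure Preserves (A B : Env S) (f : ResHom A.toRes B.toRes) (k : ℕ) : Prop where
  free : ∀ {y τ r g}, B.val (.inl y) τ r g → A.val (.inl y) τ (f.R r) (f.hom r ≫ g)
  bound : ∀ {j τ r g}, j < k → B.val (.inr j) τ r g → A.val (.inr j) τ (f.R r) (f.hom r ≫ g)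

theorem Env.PairVal.right' {A B : Env S} {a : Var ⊕ ℕ} {τ : Ty} {r : B.R} {g : B.obj r ⟶ S.ty τ}
    {n : A.R} (e : n = A.nil) (h : B.val a τ r g) :
    Env.PairVal A B a τ (n, r) ((A.dropAt e ⊗ₘ g) ≫ (λ_ _).hom) := by
  subst e
  rw [Res.dropAt_rfl]
  exact .right h

theorem Preserves.ext {A B : Env S} {f : ResHom A.toRes B.toRes} {k : ℕ} (h : Preserves A B f k)
    (x : Var) : Preserves (A.ext x) (B.ext x) (f.whiskerRight (S.vres x)) (k + 1) where
  free := by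
    rintro y τ r g (⟨h'⟩ | ⟨⟨⟩⟩)
    have := Env.PairVal.left (A := A.shift) (B := Env.slot S (.inr 0) x) (a := .inl y) (h.free h')
    simpa [ResHom.whiskerRight, MonoidalCategory.tensorHom_def] using this
  bound := by
    rintro (_ | j) τ r g hj (⟨h'⟩ | ⟨⟨⟩⟩)
    · exact h'.elim
    · have := Env.PairVal.right' (A := A.shift) (B := Env.slot S (.inr 0) x) (a := .inr 0)
        f.R_nil (Env.SlotVal.mk (S := S) (a := .inr 0) (x := x))
      -- Dropping the old environment before or after the map gives the same result, so the new
      -- variable keeps its value.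
      rw [← f.whiskerRight_drop] at this
      exact this
    · have := Env.PairVal.left (A := A.shift) (B := Env.slot S (.inr 0) x) (a := .inr (j + 1))
        (h.bound (by omega) h')
      simpa [ResHom.whiskerRight, MonoidalCategory.tensorHom_def] using this

namespace Sem

/-- A map of resources preserves the empty resource only up to a propositional equality. The primed
rules restate those rules of `Sem` that require the empty resource. -/
theorem zero' {A : Env S} {r : A.R} (e : r = A.nil) :
    Sem A r .zero .iota (A.dropAt e ≫ S.zeroMor) := by
  subst e; rw [Res.dropAt_rfl]; exact .zero

theorem succ' {A : Env S} {r : A.R} (e : r = A.nil) :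
    Sem A r .succ (.arr .iota .iota) (A.dropAt e ≫ S.succMor) := by
  subst e; rw [Res.dropAt_rfl]; exact .succ

theorem pred' {A : Env S} {r : A.R} (e : r = A.nil) :
    Sem A r .pred (.arr .iota .iota) (A.dropAt e ≫ S.predMor) := by
  subst e; rw [Res.dropAt_rfl]; exact .pred

theorem mu' {A : Env S} {r : A.R} (e : r = A.nil) {σ : Ty} {M : Term}
    {f : (A.ext (.svar σ 0)).obj (r, S.vone (.svar σ 0)) ⟶ S.ty σ}
    (h : Sem (A.ext (.svar σ 0)) (r, S.vone (.svar σ 0)) M σ f) :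
    Sem A r (.mu σ M) σ (S.muMor (A.promAt e) ((A.obj r ◁ (S.viso (.svar σ 0)).inv) ≫ f)) := by
  subst e; rw [Res.promAt_rfl]; exact .mu h

/-- The three compatibilities of a map of resources match the three uses of resources: `hom_split`
for applications and conditionals, `hom_drop` for constants, `hom_prom` for fixpoints. -/
theorem weaken {B : Env S} {r : B.R} {M : Term} {τ : Ty} {g : B.obj r ⟶ S.ty τ}
    (h : Sem B r M τ g) : ∀ {k : ℕ} {A : Env S} {f : ResHom A.toRes B.toRes}, Term.LC k M →
      Preserves A B f k → Sem A (f.R r) M τ (f.hom r ≫ g) := by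
  induction h with
  | zero =>
    intro k A f hk hf
    rw [reassoc_of% f.hom_drop]
    exact zero' f.R_nil
  | succ =>
    intro k A f hk hf
    rw [reassoc_of% f.hom_drop]
    exact succ' f.R_nil
  | pred =>
    intro k A f hk hf
    rw [reassoc_of% f.hom_drop]
    exact pred' f.R_nil
  | fvar h => exact fun hk hf => .fvar (hf.free h)
  | bvar h => exact fun hk hf => .bvar (hf.bound hk h)
  | app h h₁ h₂ ih₁ ih₂ =>
    intro k A f hk hf
    rw [reassoc_of% f.hom_split, tensorHom_comp_tensorHom_assoc]
    exact .app _ (ih₁ hk.1 hf) (ih₂ hk.2 hf)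
  | lif h h₁ h₂ h₃ ih₁ ih₂ ih₃ =>
    intro k A f hk hf
    rw [reassoc_of% f.hom_split, tensorHom_comp_tensorHom_assoc, prod.comp_lift]
    exact .lif _ (ih₁ hk.1 hf) (ih₂ hk.2.1 hf) (ih₃ hk.2.2 hf)
  | lam h ih =>
    intro k A f hk hf
    have := lam (ih (k := k + 1) hk (hf.ext _))
    rw [comp_lamMor, ← whisker_exchange_assoc]
    exact this
  | mu h ih =>
    intro k A f hk hf
    have := mu' f.R_nil (ih (k := k + 1) hk (hf.ext _))
    rw [comp_muMor _ _ f.hom_prom, ← whisker_exchange_assoc]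
    exact this

end Sem

/-- The values in an environment are unique. -/
def Env.Functional (A : Env S) : Prop :=
  ∀ {a τ r g τ' r' g'}, A.val a τ r g → A.val a τ' r' g' →
    (⟨τ, r, g⟩ : Σ τ, Σ r, (A.obj r ⟶ S.ty τ)) = ⟨τ', r', g'⟩

theorem Env.PairVal.unique_left {A B : Env S} {a : Var ⊕ ℕ} (hA : A.Functional)
    (hB : ∀ τ r g, ¬ B.val a τ r g) {τ r g τ' r' g'} (h : PairVal A B a τ r g)
    (h' : PairVal A B a τ' r' g') :
    (⟨τ, r, g⟩ : Σ τ, Σ r, ((A.tensor B).obj r ⟶ S.ty τ)) = ⟨τ', r', g'⟩ := by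
  obtain ⟨h⟩ | ⟨h⟩ := h
  · obtain ⟨h'⟩ | ⟨h'⟩ := h'
    · cases hA h h'
      rfl
    · exact (hB _ _ _ h').elim
  · exact (hB _ _ _ h).elim

theorem Env.PairVal.unique_right {A B : Env S} {a : Var ⊕ ℕ} (hB : B.Functional)
    (hA : ∀ τ r g, ¬ A.val a τ r g) {τ r g τ' r' g'} (h : PairVal A B a τ r g)
    (h' : PairVal A B a τ' r' g') :
    (⟨τ, r, g⟩ : Σ τ, Σ r, ((A.tensor B).obj r ⟶ S.ty τ)) = ⟨τ', r', g'⟩ := by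
  obtain ⟨h⟩ | ⟨h⟩ := h
  · exact (hA _ _ _ h).elim
  · obtain ⟨h'⟩ | ⟨h'⟩ := h'
    · exact (hA _ _ _ h').elim
    · cases hB h h'
      rfl

theorem Env.slot_functional (a : Var ⊕ ℕ) (x : Var) : (slot S a x).Functional := by
  rintro b τ r g τ' r' g' ⟨⟩ ⟨⟩
  rfl

theorem Env.shift_functional {A : Env S} (hA : A.Functional) : A.shift.Functional := by
  rintro (y | _ | j) τ r g τ' r' g' h h'
  · exact hA h h'
  · exact h.elim
  · exact hA h h'

theorem Env.ext_functional {A : Env S} (hA : A.Functional) (x : Var) : (A.ext x).Functional := by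
  rintro (y | _ | j) τ r g τ' r' g' h h'
  · exact PairVal.unique_left (shift_functional hA) (by rintro _ _ _ ⟨⟩) h h'
  · exact PairVal.unique_right (slot_functional _ x) (fun _ _ _ h => h) h h'
  · exact PairVal.unique_left (shift_functional hA) (by rintro _ _ _ ⟨⟩) h h'

/-- Exactly one rule applies to each term former. The induction hypotheses fix types, resources and
morphisms of the subterms, and two resources have at most one union. Type and resource belong to the
conclusion because an application hides the argument type and the splitting. -/
theorem Sem.unique {A : Env S} {r : A.R} {M : Term} {τ : Ty} {g : A.obj r ⟶ S.ty τ}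
    (h : Sem A r M τ g) : A.Functional → ∀ {τ' r' g'}, Sem A r' M τ' g' →
      (⟨τ, r, g⟩ : Σ τ, Σ r, (A.obj r ⟶ S.ty τ)) = ⟨τ', r', g'⟩ := by
  induction h with
  | zero => rintro hA _ _ _ ⟨⟩; rfl
  | succ => rintro hA _ _ _ ⟨⟩; rfl
  | pred => rintro hA _ _ _ ⟨⟩; rfl
  | fvar h =>
    intro hA _ _ _ h'
    cases h' with
    | fvar h' => exact hA h h'
  | bvar h =>
    intro hA _ _ _ h'
    cases h' with
    | bvar h' => exact hA h h'
  | app h h₁ h₂ ih₁ ih₂ =>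
    intro hA _ _ _ h'
    cases h' with
    | app h' h₁' h₂' =>
      cases ih₁ hA h₁'
      cases ih₂ hA h₂'
      cases Res.split_unique _ h h'
      rfl
  | lif h h₁ h₂ h₃ ih₁ ih₂ ih₃ =>
    intro hA _ _ _ h'
    cases h' with
    | lif h' h₁' h₂' h₃' =>
      cases ih₁ hA h₁'
      cases ih₂ hA h₂'
      cases ih₃ hA h₃'
      cases Res.split_unique _ h h'
      rfl
  | lam h ih =>
    intro hA _ _ _ h'
    cases h' with
    | lam h' =>
      cases ih (Env.ext_functional hA _) h'
      rfl
  | mu h ih =>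
    intro hA _ _ _ h'
    cases h' with
    | mu h' =>
      cases ih (Env.ext_functional hA _) h'
      rfl

end SlCategory

/-! ### Objects of bases, and tuples of values for them -/

namespace SlCategory

variable (S : SlCategory L)

/-- The object of the empty basis. -/
def ctxNil : S.ctx [] ≅ 𝟙_ L := Iso.refl _

/-- The object of a nonempty basis. -/
def ctxCons (x : Var) (Γ : Basis) : S.ctx (x :: Γ) ≅ S.var x ⊗ S.ctx Γ := Iso.refl _

/-- `ctxNil` and `ctxCons` are identities by definition. Keeping them explicit makes all composites
match syntactically, so that later proofs can rewrite. -/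
theorem split_nil_hom (Δ : Basis) :
    (S.split [] Δ).hom = (λ_ (S.ctx Δ)).inv ≫ (S.ctxNil.inv ▷ S.ctx Δ) := by
  simp only [ctxNil, Iso.refl_inv]
  erw [id_whiskerRight, Category.comp_id]
  rfl

theorem split_cons_hom (x : Var) (Γ Δ : Basis) :
    (S.split (x :: Γ) Δ).hom = (S.ctxCons x (Γ ++ Δ)).hom ≫ (S.var x ◁ (S.split Γ Δ).hom) ≫
      (α_ _ _ _).inv ≫ ((S.ctxCons x Γ).inv ▷ S.ctx Δ) := by
  simp only [ctxCons, Iso.refl_inv, Iso.refl_hom]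
  erw [id_whiskerRight, Category.comp_id, Category.id_comp]
  rfl

theorem split_cons_inv (x : Var) (Γ Δ : Basis) :
    (S.split (x :: Γ) Δ).inv = ((S.ctxCons x Γ).hom ▷ S.ctx Δ) ≫ (α_ _ _ _).hom ≫
      (S.var x ◁ (S.split Γ Δ).inv) ≫ (S.ctxCons x (Γ ++ Δ)).inv := by
  simp only [ctxCons, Iso.refl_inv, Iso.refl_hom]
  erw [id_whiskerRight, Category.comp_id, Category.id_comp]
  rfl

/-- The object of a basis with one variable. -/
def single (x : Var) : S.ctx [x] ≅ S.var x :=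
  S.ctxCons x [] ≪≫ whiskerLeftIso (S.var x) S.ctxNil ≪≫ ρ_ (S.var x)

/-- The object of a basis with two variables. -/
def pair (x y : Var) : S.ctx [x, y] ≅ S.var x ⊗ S.var y :=
  S.ctxCons x [y] ≪≫ whiskerLeftIso (S.var x) (S.single y)

theorem single_hom (x : Var) : (S.single x).hom = (ρ_ (S.var x)).hom := by
  simp only [single, Iso.trans_hom, whiskerLeftIso_hom]
  simp only [ctxCons, ctxNil, Iso.refl_hom]
  erw [MonoidalCategory.whiskerLeft_id, Category.id_comp, Category.id_comp]

theorem single_inv (x : Var) : (S.single x).inv = (ρ_ (S.var x)).inv := by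
  simp only [single, Iso.trans_inv, whiskerLeftIso_inv]
  simp only [ctxCons, ctxNil, Iso.refl_inv]
  erw [MonoidalCategory.whiskerLeft_id, Category.comp_id, Category.comp_id]

theorem pair_inv (x y : Var) : (S.pair x y).inv = (S.var x ◁ (ρ_ (S.var y)).inv) := by
  simp only [pair, Iso.trans_inv, whiskerLeftIso_inv]
  rw [single_inv]
  simp only [ctxCons, Iso.refl_inv]
  erw [Category.comp_id]
  rfl

theorem snoc_hom (Γ : Basis) (x : Var) :
    (S.snoc Γ x).hom = (S.split Γ [x]).hom ≫ (S.ctx Γ ◁ (S.single x).hom) :=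
  congrArg (fun t : S.ctx [x] ⟶ S.var x => (S.split Γ [x]).hom ≫ (S.ctx Γ ◁ t))
    (S.single_hom x).symm

theorem snoc_inv (Γ : Basis) (x : Var) :
    (S.snoc Γ x).inv = (S.ctx Γ ◁ (S.single x).inv) ≫ (S.split Γ [x]).inv := by
  rw [← cancel_mono (S.snoc Γ x).hom, Iso.inv_hom_id, snoc_hom]
  simp

theorem contract_eq (Γ : Basis) {x x₁ x₂ : Var} (c : S.var x ⟶ S.var x₁ ⊗ S.var x₂) :
    S.contract Γ c = (S.snoc Γ x).hom ≫ (S.ctx Γ ◁ (c ≫ (S.pair x₁ x₂).inv)) ≫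
      (S.split Γ [x₁, x₂]).inv :=
  congrArg (fun t : S.var x₁ ⊗ S.var x₂ ⟶ S.ctx [x₁, x₂] =>
    (S.snoc Γ x).hom ≫ (S.ctx Γ ◁ (c ≫ t)) ≫ (S.split Γ [x₁, x₂]).inv) (S.pair_inv x₁ x₂).symm

/-- The exchange of the first two variables of a basis. -/
def swap (x₁ x₂ : Var) (Δ : Basis) : S.ctx (x₁ :: x₂ :: Δ) ⟶ S.ctx (x₂ :: x₁ :: Δ) :=
  (S.ctxCons x₁ (x₂ :: Δ)).hom ≫ (S.var x₁ ◁ (S.ctxCons x₂ Δ).hom) ≫ (α_ _ _ _).inv ≫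
    ((β_ (S.var x₁) (S.var x₂)).hom ▷ S.ctx Δ) ≫ (α_ _ _ _).hom ≫
      (S.var x₂ ◁ (S.ctxCons x₁ Δ).inv) ≫ (S.ctxCons x₂ (x₁ :: Δ)).inv

theorem exchange_eq (Γ : Basis) (x₁ x₂ : Var) (Δ : Basis) :
    S.exchange Γ x₁ x₂ Δ = (S.split Γ (x₁ :: x₂ :: Δ)).hom ≫ (S.ctx Γ ◁ S.swap x₁ x₂ Δ) ≫
      (S.split Γ (x₂ :: x₁ :: Δ)).inv := by
  simp only [exchange, swap, ctxCons, Iso.refl_hom, Iso.refl_inv]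
  erw [MonoidalCategory.whiskerLeft_id, MonoidalCategory.whiskerLeft_id, Category.id_comp,
    Category.id_comp, Category.id_comp, Category.comp_id]
  rfl

variable {S}

/-- `Val A t x r g`: in the environment `A` the term `t` denotes a value `g` for the
variable `x`. -/
structure Val (A : Env S) (t : Term) (x : Var) (r : A.R) (g : A.obj r ⟶ S.var x) : Prop where
  sem : Sem A r t x.ty (g ≫ S.vev x)
  -- This is what permits a value to be duplicated, discarded and promoted. For a higher-order
  -- variable it is vacuous.
  coalg : ∀ h : x.IsGround ∨ x.IsStable, ∃ e : r = A.nil,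
    g ≫ S.varCoalg x h = A.promAt e ≫ (bang L).map g

/-- `Vals A s Γ r h`: in the environment `A` the terms `s y`, for `y` in `Γ`, denote the
values `h`. -/
inductive Vals (A : Env S) (s : Var → Term) : (Γ : Basis) → (r : A.R) →
    (A.obj r ⟶ S.ctx Γ) → Prop
  | nil : Vals A s [] A.nil (A.drop ≫ S.ctxNil.inv)
  | cons {x Γ r r₁ r₂ g k} (h : A.Split r r₁ r₂) (hx : Val A (s x) x r₁ g)
      (hΓ : Vals A s Γ r₂ k) : Vals A s (x :: Γ) r (A.split h ≫ (g ⊗ₘ k) ≫ (S.ctxCons x Γ).inv)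

namespace Vals

theorem congr {A : Env S} {s s' : Var → Term} {Γ : Basis} {r : A.R} {h : A.obj r ⟶ S.ctx Γ}
    (H : Vals A s Γ r h) (e : ∀ y ∈ Γ, s y = s' y) : Vals A s' Γ r h := by
  induction H with
  | nil => exact .nil
  | cons hs hx _ ih =>
    refine .cons hs ?_ (ih fun y hy => e y (by simp [hy]))
    rw [← e _ (by simp)]
    exact hx

theorem of_eq {A : Env S} {s : Var → Term} {Γ : Basis} {r : A.R} {h h' : A.obj r ⟶ S.ctx Γ}
    (H : Vals A s Γ r h) (e : h' = h) : Vals A s Γ r h' := e ▸ H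

theorem cons_inv {A : Env S} {s : Var → Term} {x : Var} {Γ : Basis} {r : A.R}
    {h : A.obj r ⟶ S.ctx (x :: Γ)} (H : Vals A s (x :: Γ) r h) :
    ∃ (r₁ r₂ : A.R) (hs : A.Split r r₁ r₂) (g : A.obj r₁ ⟶ S.var x) (k : A.obj r₂ ⟶ S.ctx Γ),
      Val A (s x) x r₁ g ∧ Vals A s Γ r₂ k ∧ h = A.split hs ≫ (g ⊗ₘ k) ≫ (S.ctxCons x Γ).inv := by
  cases H with
  | cons hs hx H => exact ⟨_, _, hs, _, _, hx, H, rfl⟩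

theorem nil_inv {A : Env S} {s : Var → Term} {r : A.R}
    {h : A.obj r ⟶ S.ctx []} (H : Vals A s [] r h) :
    ∃ e : r = A.nil, h = A.dropAt e ≫ S.ctxNil.inv := by
  cases H
  exact ⟨rfl, by rw [Res.dropAt_rfl]⟩

theorem nil' {A : Env S} {s : Var → Term} {r : A.R} (e : r = A.nil) :
    Vals A s [] r (A.dropAt e ≫ S.ctxNil.inv) := by
  subst e
  rw [Res.dropAt_rfl]
  exact .nil

/-- The coalgebra condition survives because `f` commutes with promotion, so only the denotations of
the terms have to be transported by hypothesis. -/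
theorem map {A B : Env S} (f : ResHom A.toRes B.toRes) {s s' : Var → Term} {Γ : Basis} {r : B.R}
    {h : B.obj r ⟶ S.ctx Γ} (H : Vals B s Γ r h)
    (e : ∀ y ∈ Γ, ∀ {r τ g}, Sem B r (s y) τ g → Sem A (f.R r) (s' y) τ (f.hom r ≫ g)) :
    Vals A s' Γ (f.R r) (f.hom r ≫ h) := by
  induction H with
  | nil =>
    rw [reassoc_of% f.hom_drop]
    exact nil' f.R_nil
  | cons hs hx _ ih =>
    rw [reassoc_of% f.hom_split, tensorHom_comp_tensorHom_assoc]
    refine .cons _ ⟨?_, ?_⟩ (ih fun y hy => e y (by simp [hy]))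
    · rw [Category.assoc]
      exact e _ (by simp) hx.sem
    · intro h
      obtain ⟨e', he⟩ := hx.coalg h
      refine ⟨(congrArg f.R e').trans f.R_nil, ?_⟩
      rw [Category.assoc, he, reassoc_of% (f.hom_promAt e'), Functor.map_comp]

theorem append {A : Env S} {s : Var → Term} {Γ Δ : Basis} {r r₁ r₂ : A.R}
    {h₁ : A.obj r₁ ⟶ S.ctx Γ} {h₂ : A.obj r₂ ⟶ S.ctx Δ} (hs : A.Split r r₁ r₂)
    (H₁ : Vals A s Γ r₁ h₁) (H₂ : Vals A s Δ r₂ h₂) :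
    Vals A s (Γ ++ Δ) r (A.split hs ≫ (h₁ ⊗ₘ h₂) ≫ (S.split Γ Δ).inv) := by
  induction H₁ generalizing r with
  | nil =>
    cases A.eq_of_split_nil (A.split_symm hs)
    refine of_eq (Γ := [] ++ Δ) H₂ ?_
    rw [← cancel_mono (S.split [] _).hom, Category.assoc, Category.assoc, Iso.inv_hom_id,
      Category.comp_id, A.drop_split_tensor, split_nil_hom]
  | cons hs' hx _ ih =>
    obtain ⟨s, k, k'⟩ := A.split_regroup' hs hs'
    refine of_eq (Vals.cons k hx (ih k')) ?_
    rw [split_cons_inv, ← tensorHom_id, tensorHom_comp_tensorHom_assoc]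
    simp only [Category.assoc, Iso.inv_hom_id, Category.comp_id]
    rw [← reassoc_of% (A.split_assoc_tensor k k' hs' hs), ← id_tensorHom,
      tensorHom_comp_tensorHom_assoc]
    simp only [Category.assoc, Category.comp_id]
    rfl

/-- A tuple is built by splitting off one variable at a time; regrouping these splittings yields a
single splitting between the two bases. This is the form needed where a rule has two premises. -/
theorem append_inv {A : Env S} {s : Var → Term} {Γ Δ : Basis} {r : A.R}
    {h : A.obj r ⟶ S.ctx (Γ ++ Δ)} (H : Vals A s (Γ ++ Δ) r h) :
    ∃ (r₁ r₂ : A.R) (hs : A.Split r r₁ r₂) (h₁ : A.obj r₁ ⟶ S.ctx Γ) (h₂ : A.obj r₂ ⟶ S.ctx Δ),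
      Vals A s Γ r₁ h₁ ∧ Vals A s Δ r₂ h₂ ∧
        h ≫ (S.split Γ Δ).hom = A.split hs ≫ (h₁ ⊗ₘ h₂) := by
  induction Γ generalizing r with
  | nil =>
    refine ⟨A.nil, r, A.split_symm (A.split_nil r), _, h, .nil, H, ?_⟩
    rw [A.drop_split_tensor, split_nil_hom]
  | cons x Γ ih =>
    obtain ⟨_, _, hs, g, h', hx, H', rfl⟩ := cons_inv (Γ := Γ ++ Δ) H
    obtain ⟨r₁, r₂, hs', h₁, h₂, H₁, H₂, e⟩ := ih H'
    obtain ⟨t, k, k'⟩ := A.split_regroup hs hs'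
    refine ⟨t, r₂, k', _, h₂, .cons k hx H₁, H₂, ?_⟩
    rw [split_cons_hom]
    simp only [Category.assoc, List.cons_append]
    rw [Iso.inv_hom_id_assoc, ← id_tensorHom, tensorHom_comp_tensorHom_assoc, e,
      Category.comp_id, reassoc_of% (A.split_assoc_tensor hs hs' k k'), Iso.hom_inv_id_assoc,
      ← tensorHom_id, tensorHom_comp_tensorHom]
    simp

end Vals

end SlCategory

/-! ### Structural rules acting on tuples of values -/

namespace SlCategory

variable {S : SlCategory L} {A : Env S} {s : Var → Term}

namespace Vals

theorem single_inv {x : Var} {r : A.R} {h : A.obj r ⟶ S.ctx [x]} (H : Vals A s [x] r h) :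
    Val A (s x) x r (h ≫ (S.single x).hom) := by
  obtain ⟨r₁, r₂, hs, g, k, hx, H', rfl⟩ := H.cons_inv
  obtain ⟨rfl, rfl⟩ := H'.nil_inv
  cases A.eq_of_split_nil hs
  rw [Res.dropAt_rfl]
  convert hx using 1
  rw [single]
  simp only [Iso.trans_hom, whiskerLeftIso_hom, Category.assoc, Iso.inv_hom_id_assoc]
  rw [reassoc_of% (A.split_drop_tensor hs), ← MonoidalCategory.whiskerLeft_comp_assoc,
    Iso.inv_hom_id]
  simp

theorem single {x : Var} {r : A.R} {g : A.obj r ⟶ S.var x} (hx : Val A (s x) x r g) :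
    Vals A s [x] r (g ≫ (S.single x).inv) := by
  refine of_eq (.cons (A.split_nil r) hx .nil) ?_
  rw [reassoc_of% A.split_drop_tensor]
  simp [SlCategory.single]

theorem snoc {Γ : Basis} {x : Var} {r r₁ r₂ : A.R} {h₁ : A.obj r₁ ⟶ S.ctx Γ}
    {g : A.obj r₂ ⟶ S.var x} (hs : A.Split r r₁ r₂) (H : Vals A s Γ r₁ h₁)
    (hx : Val A (s x) x r₂ g) :
    Vals A s (Γ ++ [x]) r (A.split hs ≫ (h₁ ⊗ₘ g) ≫ (S.snoc Γ x).inv) := by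
  refine of_eq (append hs H (single hx)) ?_
  rw [snoc_inv, ← id_tensorHom, tensorHom_comp_tensorHom_assoc, Category.comp_id]

theorem snoc_inv {Γ : Basis} {x : Var} {r : A.R} {h : A.obj r ⟶ S.ctx (Γ ++ [x])}
    (H : Vals A s (Γ ++ [x]) r h) :
    ∃ (r₁ r₂ : A.R) (hs : A.Split r r₁ r₂) (h₁ : A.obj r₁ ⟶ S.ctx Γ) (g : A.obj r₂ ⟶ S.var x),
      Vals A s Γ r₁ h₁ ∧ Val A (s x) x r₂ g ∧
        h ≫ (S.snoc Γ x).hom = A.split hs ≫ (h₁ ⊗ₘ g) := by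
  obtain ⟨r₁, r₂, hs, h₁, h₂, H₁, H₂, e⟩ := append_inv H
  refine ⟨r₁, r₂, hs, h₁, _, H₁, single_inv H₂, ?_⟩
  rw [snoc_hom, reassoc_of% e, ← id_tensorHom, tensorHom_comp_tensorHom, Category.comp_id]

theorem swap {x₁ x₂ : Var} {Δ : Basis} {r : A.R} {h : A.obj r ⟶ S.ctx (x₁ :: x₂ :: Δ)}
    (H : Vals A s (x₁ :: x₂ :: Δ) r h) : Vals A s (x₂ :: x₁ :: Δ) r (h ≫ S.swap x₁ x₂ Δ) := by
  obtain ⟨r₁, r', hs, g₁, k, hx₁, H', rfl⟩ := H.cons_inv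
  obtain ⟨r₂, r₃, hs', g₂, k, hx₂, H'', rfl⟩ := H'.cons_inv
  obtain ⟨t, k₁, k₂⟩ := A.split_regroup hs hs'
  -- The first two parts are regrouped into one, exchanged by symmetry of splitting, and separated
  -- again.
  obtain ⟨q, k₃, k₄⟩ := A.split_regroup' k₂ (A.split_symm k₁)
  refine of_eq (.cons k₃ hx₂ (.cons k₄ hx₁ H'')) ?_
  simp only [SlCategory.swap, Category.assoc, Iso.inv_hom_id_assoc]
  rw [← id_tensorHom, tensorHom_comp_tensorHom_assoc]
  simp only [Category.assoc, Iso.inv_hom_id, Category.comp_id]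
  rw [reassoc_of% (A.split_assoc_tensor hs hs' k₁ k₂), Iso.hom_inv_id_assoc, ← tensorHom_id,
    tensorHom_comp_tensorHom_assoc, Category.assoc, BraidedCategory.braiding_naturality,
    reassoc_of% (A.split_braiding k₁), Category.comp_id,
    ← reassoc_of% (A.split_assoc_tensor k₃ k₄ _ k₂), ← id_tensorHom,
    tensorHom_comp_tensorHom_assoc]
  simp only [Category.assoc, Category.comp_id]

theorem exchange {Γ : Basis} {x₁ x₂ : Var} {Δ : Basis} {r : A.R}
    {h : A.obj r ⟶ S.ctx (Γ ++ x₁ :: x₂ :: Δ)} (H : Vals A s (Γ ++ x₁ :: x₂ :: Δ) r h) :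
    Vals A s (Γ ++ x₂ :: x₁ :: Δ) r (h ≫ S.exchange Γ x₁ x₂ Δ) := by
  obtain ⟨r₁, r₂, hs, h₁, h₂, H₁, H₂, e⟩ := append_inv H
  refine of_eq (append hs H₁ H₂.swap) ?_
  rw [exchange_eq, reassoc_of% e, ← id_tensorHom, tensorHom_comp_tensorHom_assoc,
    Category.comp_id]

theorem weaken {Γ : Basis} {x : Var} {r : A.R} {h : A.obj r ⟶ S.ctx (Γ ++ [x])}
    (H : Vals A s (Γ ++ [x]) r h) (hx : x.IsGround ∨ x.IsStable) {w : S.var x ⟶ 𝟙_ L}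
    (hw : ∀ {t g}, Val A t x A.nil g → g ≫ w = A.drop) : Vals A s Γ r (h ≫ S.weaken Γ w) := by
  obtain ⟨r₁, r₂, hs, h₁, g, H₁, H₂, e⟩ := snoc_inv H
  -- The value of a discardable variable lives on the empty resource, so the rest of the tuple
  -- already has the full resource.
  obtain ⟨rfl, -⟩ := H₂.coalg hx
  cases A.eq_of_split_nil hs
  refine of_eq H₁ ?_
  rw [SlCategory.weaken, reassoc_of% e, ← id_tensorHom, tensorHom_comp_tensorHom_assoc, hw H₂,
    Category.comp_id, ← Category.comp_id A.drop, reassoc_of% (A.split_drop_tensor hs)]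
  simp

/-- Both new variables receive the term of the contracted one. Altering the substitution at `x₁` and
`x₂` does not disturb the tuple for `Γ`, since neither occurs there. -/
theorem contract {Γ : Basis} {x x₁ x₂ : Var} {r : A.R} {h : A.obj r ⟶ S.ctx (Γ ++ [x])}
    (H : Vals A s (Γ ++ [x]) r h) (hx : x.IsGround ∨ x.IsStable)
    {c : S.var x ⟶ S.var x₁ ⊗ S.var x₂}
    (hc : ∀ {t g}, Val A t x A.nil g → ∃ g₁ g₂, Val A t x₁ A.nil g₁ ∧ Val A t x₂ A.nil g₂ ∧
      g ≫ c = A.split (A.split_nil A.nil) ≫ (g₁ ⊗ₘ g₂)) (h₁ : x₁ ∉ Γ) (h₂ : x₂ ∉ Γ) :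
    Vals A (fun y => if y = x₁ ∨ y = x₂ then s x else s y) (Γ ++ [x₁, x₂]) r
      (h ≫ S.contract Γ c) := by
  obtain ⟨r₁, r₂, hs, k₁, g, H₁, H₂, e⟩ := snoc_inv H
  obtain ⟨rfl, -⟩ := H₂.coalg hx
  obtain ⟨g₁, g₂, hg₁, hg₂, e'⟩ := hc H₂
  have H' : Vals A (fun y => if y = x₁ ∨ y = x₂ then s x else s y) Γ r₁ k₁ := by
    refine H₁.congr fun y hy => ?_
    rw [if_neg]
    rintro (rfl | rfl) <;> contradiction
  refine of_eq (append hs H' (.cons (g := g₁) (A.split_nil _) ?_ (single (g := g₂) ?_))) ?_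
  · simpa using hg₁
  · simpa using hg₂
  · rw [contract_eq, reassoc_of% e, ← id_tensorHom, tensorHom_comp_tensorHom_assoc,
      reassoc_of% e', Category.comp_id]
    simp only [pair, Iso.trans_inv, whiskerLeftIso_inv]
    rw [← id_tensorHom, tensorHom_comp_tensorHom_assoc, Category.comp_id]

end Vals

end SlCategory

/-! ### The interpretation in terms of named morphisms; coalgebras of bases; substitutions under
binders -/

namespace SlCategory

section Morphisms

variable (S : SlCategory L)

/-- The coalgebra of a basis of ground and stable variables. -/
def ctxCoalg (Γ : Basis) (hΓ : ∀ x ∈ Γ, x.IsGround ∨ x.IsStable) :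
    S.ctx Γ ⟶ (bang L).obj (S.ctx Γ) :=
  S.pδ Γ hΓ ≫ S.q Γ

theorem ctxCoalg_nil (h : ∀ x ∈ ([] : Basis), x.IsGround ∨ x.IsStable) :
    S.ctxNil.inv ≫ S.ctxCoalg [] h = ε (bang L).toFunctor ≫ (bang L).map S.ctxNil.inv := by
  simp only [ctxCoalg, ctxNil, Iso.refl_inv, pδ, q]
  erw [(bang L).map_id, Category.id_comp, Category.id_comp, Category.comp_id]

theorem ctxCoalg_cons (x : Var) (Γ : Basis) (h : ∀ y ∈ x :: Γ, y.IsGround ∨ y.IsStable) :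
    (S.ctxCons x Γ).inv ≫ S.ctxCoalg (x :: Γ) h =
      (S.varCoalg x (h x (by simp)) ⊗ₘ S.ctxCoalg Γ fun y hy => h y (by simp [hy])) ≫
        μ (bang L).toFunctor _ _ ≫ (bang L).map (S.ctxCons x Γ).inv := by
  simp only [ctxCoalg, ctxCons, Iso.refl_inv, pδ, q]
  erw [(bang L).map_id, Category.id_comp, Category.comp_id]
  exact tensor_whisker_μ _ _ _

/-- `Γ, x^σ` for an ordinary variable `x`. -/
def snocVar (Γ : Basis) (σ : Ty) (i : ℕ) :
    S.ctx (Γ ++ [.var σ i]) ≅ S.ctx Γ ⊗ S.var (.var σ 0) := S.snoc Γ (.var σ i)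

/-- `Γ, ϝ^σ` for a stable variable `ϝ`. -/
def snocSVar (Γ : Basis) (σ : Ty) (i : ℕ) :
    S.ctx (Γ ++ [.svar σ i]) ≅ S.ctx Γ ⊗ S.var (.svar σ 0) := S.snoc Γ (.svar σ i)

/-- Weakening of a ground variable. -/
def gwMor (i : ℕ) : S.var (.var .iota i) ⟶ 𝟙_ L := ComonObj.counit (X := S.N.A)

/-- Contraction of ground variables. -/
def gcMor (i i₁ i₂ : ℕ) : S.var (.var .iota i) ⟶ S.var (.var .iota i₁) ⊗ S.var (.var .iota i₂) :=
  ComonObj.comul (X := S.N.A)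

/-- Weakening of a stable variable. -/
def swMor (σ : Ty) (i : ℕ) : S.var (.svar σ i) ⟶ 𝟙_ L :=
  ComonObj.counit (X := (bang L).obj (S.ty σ))

/-- Contraction of stable variables. -/
def scMor (σ : Ty) (i i₁ i₂ : ℕ) : S.var (.svar σ i) ⟶ S.var (.svar σ i₁) ⊗ S.var (.svar σ i₂) :=
  ComonObj.comul (X := (bang L).obj (S.ty σ))

section Den

variable {Γ Δ : Basis} {M N P Q : Term} {σ τ : Ty}

theorem den_z : S.den .z = S.ctxNil.hom ≫ S.zeroMor := (Category.id_comp _).symm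

theorem den_s : S.den .s = S.ctxNil.hom ≫ S.succMor := (Category.id_comp _).symm

theorem den_p : S.den .p = S.ctxNil.hom ≫ S.predMor := (Category.id_comp _).symm

theorem den_lif (h : Γ.Disjoint Δ) (D : Deriv Γ M .iota) (D₁ : Deriv Δ P .iota)
    (D₂ : Deriv Δ Q .iota) : S.den (.lif h D D₁ D₂) =
      (S.split Γ Δ).hom ≫ (S.den D ⊗ₘ prod.lift (S.den D₁) (S.den D₂)) ≫ S.lifMor := rfl

theorem den_ap (h : Γ.Disjoint Δ) (D₁ : Deriv Γ M (.arr σ τ)) (D₂ : Deriv Δ N σ) :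
    S.den (.ap h D₁ D₂) = (S.split Γ Δ).hom ≫ (S.den D₁ ⊗ₘ S.den D₂) ≫ S.apMor σ τ := rfl

theorem den_gv (i : ℕ) :
    S.den (.gv i) = (S.single (.var .iota i)).hom ≫ S.vev (.var .iota i) := by
  rw [single_hom]; exact (Category.comp_id _).symm

theorem den_hv (i : ℕ) :
    S.den (.hv σ τ i) = (S.single (.var (.arr σ τ) i)).hom ≫ S.vev (.var (.arr σ τ) i) := by
  rw [single_hom]; exact (Category.comp_id _).symm

theorem den_sv (i : ℕ) :
    S.den (.sv σ i) = (S.single (.svar σ i)).hom ≫ S.vev (.svar σ i) := by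
  rw [single_hom]; rfl

theorem den_gw (i : ℕ) (h : .var .iota i ∉ Γ) (D : Deriv Γ M τ) :
    S.den (.gw i h D) = S.weaken Γ (S.gwMor i) ≫ S.den D := rfl

theorem den_sw (i : ℕ) (h : .svar σ i ∉ Γ) (D : Deriv Γ M τ) :
    S.den (.sw i h D) = S.weaken Γ (S.swMor σ i) ≫ S.den D := rfl

theorem den_gc (i i₁ i₂ : ℕ) (h : .var .iota i ∉ Γ)
    (D : Deriv (Γ ++ [.var .iota i₁, .var .iota i₂]) M τ) :
    S.den (.gc i i₁ i₂ h D) = S.contract Γ (S.gcMor i i₁ i₂) ≫ S.den D := rfl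

theorem den_sc (i i₁ i₂ : ℕ) (h : .svar σ i ∉ Γ)
    (D : Deriv (Γ ++ [.svar σ i₁, .svar σ i₂]) M τ) :
    S.den (.sc i i₁ i₂ h D) = S.contract Γ (S.scMor σ i i₁ i₂) ≫ S.den D := rfl

theorem den_lam (i : ℕ) (D : Deriv (Γ ++ [.var σ i]) M τ) :
    S.den (.lam i D) = S.lamMor ((S.snocVar Γ σ i).inv ≫ S.den D) := rfl

theorem den_mu (i : ℕ) (hΓ : ∀ x ∈ Γ, x.IsGround) (hΔ : ∀ x ∈ Δ, x.IsStable)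
    (D : Deriv ((Γ ++ Δ) ++ [.svar σ i]) M σ) :
    S.den (.mu i hΓ hΔ D) = S.muMor
      (S.ctxCoalg (Γ ++ Δ) fun x hx => (List.mem_append.1 hx).imp (hΓ x) (hΔ x))
      ((S.snocSVar (Γ ++ Δ) σ i).inv ≫ S.den D) := by
  simp only [muMor, ctxCoalg, Category.assoc]
  exact (Category.assoc _ _ _).trans (congrArg _ (Category.assoc _ _ _))

end Den

end Morphisms

variable {S : SlCategory L} {A : Env S}

/-- Each component is a coalgebra morphism from the empty resource, and so are the splitting and
dropping of that resource (`Res.prom_map_split`, `Res.prom_map_drop`). Hence a tuple for a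
promotable basis uses no linear variable and commutes with promotion. -/
theorem Vals.coalg {s : Var → Term} {Γ : Basis} {r : A.R} {h : A.obj r ⟶ S.ctx Γ}
    (H : Vals A s Γ r h) (hΓ : ∀ x ∈ Γ, x.IsGround ∨ x.IsStable) :
    ∃ e : r = A.nil, h ≫ S.ctxCoalg Γ hΓ = A.promAt e ≫ (bang L).map h := by
  induction H with
  | nil =>
    refine ⟨rfl, ?_⟩
    rw [Category.assoc, ctxCoalg_nil, Res.promAt_rfl, Functor.map_comp,
      reassoc_of% A.prom_map_drop]
  | cons hs hx _ ih =>
    obtain ⟨rfl, e⟩ := hx.coalg (hΓ _ (by simp))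
    obtain ⟨rfl, e'⟩ := ih fun y hy => hΓ y (by simp [hy])
    cases A.eq_of_split_nil hs
    refine ⟨rfl, ?_⟩
    rw [Category.assoc, Category.assoc, ctxCoalg_cons, tensorHom_comp_tensorHom_assoc, e, e',
      Res.promAt_rfl, Functor.map_comp, Functor.map_comp, reassoc_of% A.prom_map_split,
      ← tensorHom_comp_tensorHom_assoc, μ_natural_assoc]

/-- A substitution is stable if its values do not change under binders. -/
def Stable (S : SlCategory L) (s : ℕ → Var → Term) : Prop :=
  ∀ ⦃A : Env S⦄ ⦃x : Var⦄ ⦃r : A.R⦄ ⦃d : ℕ⦄ ⦃y : Var⦄ ⦃τ : Ty⦄ ⦃g : A.obj r ⟶ S.ty τ⦄,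
    Sem A r (s d y) τ g →
      Sem (A.ext x) (r, (S.vres x).nil) (s (d + 1) y) τ
        ((ResHom.fst A.shift.toRes (S.vres x)).hom r ≫ g)

theorem Env.PairVal.left' {A B : Env S} {a : Var ⊕ ℕ} {τ : Ty} {r : A.R} {g : A.obj r ⟶ S.ty τ}
    (h : A.val a τ r g) :
    Env.PairVal A B a τ (r, B.nil) ((ResHom.fst A.toRes B.toRes).hom r ≫ g) := by
  have := Env.PairVal.left (B := B) h
  rwa [MonoidalCategory.tensorHom_def', Category.assoc, rightUnitor_naturality,
    ← Category.assoc] at this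

theorem Env.PairVal.right'' {A B : Env S} {a : Var ⊕ ℕ} {τ : Ty} {r : B.R} {g : B.obj r ⟶ S.ty τ}
    (h : B.val a τ r g) :
    Env.PairVal A B a τ (A.nil, r) ((ResHom.snd A.toRes B.toRes).hom r ≫ g) := by
  have := Env.PairVal.right (A := A) h
  rwa [MonoidalCategory.tensorHom_def, Category.assoc, leftUnitor_naturality,
    ← Category.assoc] at this

/-- The bound is `0` because an extension shifts every bound index. Only locally closed terms can
therefore be weakened along this map. -/
theorem preserves_ext_fst (A : Env S) (x : Var) :
    Preserves (A.ext x) A (ResHom.fst A.shift.toRes (S.vres x)) 0 where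
  free h := Env.PairVal.left' (A := A.shift) (B := Env.slot S (.inr 0) x) (a := .inl _) h
  bound h := absurd h (by omega)

theorem stable_const {t : Var → Term} (h : ∀ y, Term.LC 0 (t y)) : Stable S fun _ => t :=
  fun _ _ _ _ _ _ _ H => H.weaken (h _) (preserves_ext_fst _ _)

/-- Under one more binder the index `d` standing for `x` becomes `d + 1`, which is exactly how an
extended environment renumbers its values. -/
theorem Stable.push {s : ℕ → Var → Term} (hs : Stable S s) (x : Var) :
    Stable S (Term.push s x) := by
  intro A z r d y τ g h
  rw [Term.push] at h ⊢
  split_ifs with e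
  · rw [if_pos e] at h
    cases h with
    | bvar h =>
      exact .bvar (Env.PairVal.left' (A := A.shift) (B := Env.slot S (.inr 0) z)
        (a := .inr (d + 1)) h)
  · rw [if_neg e] at h
    exact hs h

theorem Stable.ite {s : ℕ → Var → Term} (hs : Stable S s) (p : Var → Prop) [DecidablePred p]
    (z : Var) : Stable S fun d y => if p y then s d z else s d y := by
  intro A x r d y τ g h
  dsimp only at h ⊢
  split_ifs with e
  · rw [if_pos e] at h
    exact hs h
  · rw [if_neg e] at h
    exact hs h

theorem Val.reindex_var {t : Term} {σ : Ty} {i j : ℕ} {r : A.R}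
    {g : A.obj r ⟶ S.var (.var σ i)} (h : Val A t (.var σ i) r g) :
    Val A t (.var σ j) r g := by
  cases σ with
  | iota => exact ⟨h.sem, h.coalg⟩
  | arr => exact ⟨h.sem, fun h => (h.elim id id : False).elim⟩

theorem Val.reindex_svar {t : Term} {σ : Ty} {i j : ℕ} {r : A.R}
    {g : A.obj r ⟶ S.var (.svar σ i)} (h : Val A t (.svar σ i) r g) :
    Val A t (.svar σ j) r g := ⟨h.sem, h.coalg⟩

/-- A variable is a value for itself. -/
theorem slot_coalg (x : Var) (h : x.IsGround ∨ x.IsStable) :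
    ∃ e : S.vone x = (S.vres x).nil,
      (S.viso x).hom ≫ S.varCoalg x h = (S.vres x).promAt e ≫ (bang L).map (S.viso x).hom := by
  rcases x with ⟨_ | ⟨σ, τ⟩, i⟩ | ⟨σ, i⟩
  · exact ⟨rfl, id_coalg S.N.a⟩
  · exact (h.elim id id : False).elim
  · exact ⟨rfl, id_coalg ((bang L).δ.app (S.ty σ))⟩

theorem val_bvar_zero (A : Env S) (x : Var) :
    Val (A.ext x) (.bvar 0) x ((ResHom.snd A.shift.toRes (S.vres x)).R (S.vone x))
      ((ResHom.snd A.shift.toRes (S.vres x)).hom (S.vone x) ≫ (S.viso x).hom) where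
  sem := by
    rw [Category.assoc]
    exact .bvar (Env.PairVal.right'' (A := A.shift) (B := Env.slot S (.inr 0) x) .mk)
  coalg h := by
    obtain ⟨e, he⟩ := slot_coalg (S := S) x h
    refine ⟨congrArg (Prod.mk _) e, ?_⟩
    rw [Category.assoc, he, reassoc_of% (ResHom.hom_promAt _ e), Functor.map_comp]

end SlCategory

end

end SlLambda

/-! ### Soundness of the interpretation of derivations -/

namespace SlLambda

noncomputable section

open Functor.LaxMonoidal

variable {L : Type u} [Category.{v} L] [MonoidalCategory L] [SymmetricCategory L]
  [MonoidalClosed L] [LinearCategory L] [HasFiniteProducts L]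

theorem not_mem_of_nodup_snoc {Γ : Basis} {x : Var} (h : (Γ ++ [x]).Nodup) : x ∉ Γ :=
  fun hm => (List.nodup_append'.1 h).2.2 hm (by simp)

theorem Term.push_self (s : ℕ → Var → Term) (x : Var) (d : ℕ) : push s x d x = bvar d :=
  if_pos rfl

namespace SlCategory

variable {S : SlCategory L} {A : Env S} {s : ℕ → Var → Term}

namespace Vals

theorem single_sem {s : Var → Term} {x : Var} {r : A.R} {h : A.obj r ⟶ S.ctx [x]}
    (H : Vals A s [x] r h) : Sem A r (s x) x.ty (h ≫ (S.single x).hom ≫ S.vev x) := by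
  rw [← Category.assoc]
  exact H.single_inv.sem

theorem snocVar {s : Var → Term} {Γ : Basis} {σ : Ty} {i : ℕ} {r r₁ r₂ : A.R}
    {h₁ : A.obj r₁ ⟶ S.ctx Γ} {g : A.obj r₂ ⟶ S.var (.var σ 0)} (hs : A.Split r r₁ r₂)
    (H : Vals A s Γ r₁ h₁) (hx : Val A (s (.var σ i)) (.var σ 0) r₂ g) :
    Vals A s (Γ ++ [.var σ i]) r (A.split hs ≫ (h₁ ⊗ₘ g) ≫ (S.snocVar Γ σ i).inv) :=
  snoc hs H hx.reindex_var

theorem snocSVar {s : Var → Term} {Γ : Basis} {σ : Ty} {i : ℕ} {r r₁ r₂ : A.R}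
    {h₁ : A.obj r₁ ⟶ S.ctx Γ} {g : A.obj r₂ ⟶ S.var (.svar σ 0)} (hs : A.Split r r₁ r₂)
    (H : Vals A s Γ r₁ h₁) (hx : Val A (s (.svar σ i)) (.svar σ 0) r₂ g) :
    Vals A s (Γ ++ [.svar σ i]) r (A.split hs ≫ (h₁ ⊗ₘ g) ≫ (S.snocSVar Γ σ i).inv) :=
  snoc hs H hx.reindex_svar

theorem push {Γ : Basis} {r : A.R} {h : A.obj r ⟶ S.ctx Γ} (H : Vals A (s 0) Γ r h)
    (hs : Stable S s) {x : Var} (hx : x ∉ Γ) (z : Var) :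
    Vals (A.ext z) (Term.push s x 0) Γ ((ResHom.fst A.shift.toRes (S.vres z)).R r)
      ((ResHom.fst A.shift.toRes (S.vres z)).hom r ≫ h) := by
  refine Vals.map (A := A.ext z) (B := A) (ResHom.fst A.shift.toRes (S.vres z)) H
    fun y hy r τ g hg => ?_
  rw [Term.push, if_neg (by rintro rfl; exact hx hy)]
  exact hs hg

theorem ext_split (A : Env S) (r : A.R) (z : Var) :
    (A.ext z).Split (r, S.vone z) ((ResHom.fst A.shift.toRes (S.vres z)).R r)
      ((ResHom.snd A.shift.toRes (S.vres z)).R (S.vone z)) :=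
  ⟨A.split_nil r, (S.vres z).split_symm ((S.vres z).split_nil _)⟩

theorem ext_split_tensor (A : Env S) (r : A.R) (z : Var) {X Y : L} (h : A.obj r ⟶ X)
    (k : (S.vres z).obj (S.vone z) ⟶ Y) :
    (A.ext z).split (ext_split A r z) ≫ ((ResHom.fst A.shift.toRes (S.vres z)).hom r ≫ h ⊗ₘ
      (ResHom.snd A.shift.toRes (S.vres z)).hom (S.vone z) ≫ k) = (h ⊗ₘ k) := by
  rw [← tensorHom_comp_tensorHom]
  exact (Category.assoc _ _ _).symm.trans
    ((congrArg (· ≫ (h ⊗ₘ k)) (Res.split_fst_snd A.shift.toRes (S.vres z) _)).trans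
      (Category.id_comp _))

/-- The old tuple is weakened along the first projection and the index `0` supplies the new value
through the second. The splitting of the extended resource cancels both projections. -/
theorem pushVar {Γ : Basis} {σ : Ty} {i : ℕ} {r : A.R} {h : A.obj r ⟶ S.ctx Γ}
    (H : Vals A (s 0) Γ r h) (hs : Stable S s) (hx : .var σ i ∉ Γ) :
    Vals (A.ext (.var σ 0)) (Term.push s (.var σ i) 0) (Γ ++ [.var σ i]) (r, S.vone (.var σ 0))
      ((h ⊗ₘ (S.viso (.var σ 0)).hom) ≫ (S.snocVar Γ σ i).inv) := by
  have hv := val_bvar_zero A (.var σ 0)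
  rw [← Term.push_self s (.var σ i) 0] at hv
  refine of_eq (snocVar (ext_split A r (.var σ 0)) (H.push hs hx _) hv) ?_
  exact ((Category.assoc _ _ _).symm.trans
    (congrArg (· ≫ (S.snocVar Γ σ i).inv) (ext_split_tensor A r (.var σ 0) h _))).symm

theorem pushSVar {Γ : Basis} {σ : Ty} {i : ℕ} {r : A.R} {h : A.obj r ⟶ S.ctx Γ}
    (H : Vals A (s 0) Γ r h) (hs : Stable S s) (hx : .svar σ i ∉ Γ) :
    Vals (A.ext (.svar σ 0)) (Term.push s (.svar σ i) 0) (Γ ++ [.svar σ i]) (r, S.vone (.svar σ 0))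
      ((h ⊗ₘ (S.viso (.svar σ 0)).hom) ≫ (S.snocSVar Γ σ i).inv) := by
  have hv := val_bvar_zero A (.svar σ 0)
  rw [← Term.push_self s (.svar σ i) 0] at hv
  refine of_eq (snocSVar (ext_split A r (.svar σ 0)) (H.push hs hx _) hv) ?_
  exact ((Category.assoc _ _ _).symm.trans
    (congrArg (· ≫ (S.snocSVar Γ σ i).inv) (ext_split_tensor A r (.svar σ 0) h _))).symm

end Vals

/-- The interpretation of derivations is sound. -/
theorem Sem.sound {Γ : Basis} {M : Term} {τ : Ty} (D : Deriv Γ M τ) : ∀ {A : Env S}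
    {s : ℕ → Var → Term} {r : A.R} {h : A.obj r ⟶ S.ctx Γ}, Stable S s → Vals A (s 0) Γ r h →
      Sem A r (M.trav s 0) τ (h ≫ S.den D) := by
  induction D with
  | z =>
    intro A s r h hs H
    obtain ⟨rfl, rfl⟩ := H.nil_inv
    rw [den_z, Category.assoc, Iso.inv_hom_id_assoc, Res.dropAt_rfl]
    exact .zero
  | s =>
    intro A s r h hs H
    obtain ⟨rfl, rfl⟩ := H.nil_inv
    rw [den_s, Category.assoc, Iso.inv_hom_id_assoc, Res.dropAt_rfl]
    exact .succ
  | p =>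
    intro A s r h hs H
    obtain ⟨rfl, rfl⟩ := H.nil_inv
    rw [den_p, Category.assoc, Iso.inv_hom_id_assoc, Res.dropAt_rfl]
    exact .pred
  | lif hd D D₁ D₂ ih ih₁ ih₂ =>
    intro A s r h hs H
    obtain ⟨r₁, r₂, k, h₁, h₂, H₁, H₂, e⟩ := H.append_inv
    rw [den_lif, reassoc_of% e, tensorHom_comp_tensorHom_assoc, prod.comp_lift]
    exact .lif k (ih hs H₁) (ih₁ hs H₂) (ih₂ hs H₂)
  | ap hd D₁ D₂ ih₁ ih₂ =>
    intro A s r h hs H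
    obtain ⟨r₁, r₂, k, h₁, h₂, H₁, H₂, e⟩ := H.append_inv
    rw [den_ap, reassoc_of% e, tensorHom_comp_tensorHom_assoc]
    exact .app k (ih₁ hs H₁) (ih₂ hs H₂)
  | ex D ih =>
    intro A s r h hs H
    have := ih hs H.exchange
    rw [Category.assoc] at this
    exact this
  | gv i =>
    intro A s r h hs H
    rw [den_gv]
    exact H.single_sem
  | hv σ τ i =>
    intro A s r h hs H
    rw [den_hv]
    exact H.single_sem
  | sv σ i =>
    intro A s r h hs H
    rw [den_sv]
    exact H.single_sem
  | gw i hi D ih =>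
    intro A s r h hs H
    rw [den_gw, ← Category.assoc]
    refine ih hs (H.weaken (.inl trivial) fun {t g} hg => ?_)
    obtain ⟨_, e⟩ := hg.coalg (.inl trivial)
    rw [Res.promAt_rfl] at e
    exact A.coalg_counit (X := S.N.A) (a := S.N.a) (g := g) e
  | sw i hi D ih =>
    intro A s r h hs H
    rw [den_sw, ← Category.assoc]
    refine ih hs (H.weaken (.inr trivial) fun {t g} hg => ?_)
    obtain ⟨_, e⟩ := hg.coalg (.inr trivial)
    rw [Res.promAt_rfl] at e
    have := isComonHom_comult (L := L)
    exact A.coalg_counit (X := (bang L).obj (S.ty _)) (a := (bang L).δ.app (S.ty _)) (g := g) e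
  | gc i i₁ i₂ hi D ih =>
    intro A s r h hs H
    have hD := List.nodup_append'.1 D.nodup
    rw [den_gc, ← Category.assoc, Term.trav_merge]
    refine ih (hs.ite (fun y => y = .var .iota i₁ ∨ y = .var .iota i₂) (.var .iota i))
      (H.contract (.inl trivial) (fun {t g} hg => ?_)
      (fun hm => hD.2.2 hm (by simp)) (fun hm => hD.2.2 hm (by simp)))
    -- The same value serves for both copies: objects of variables ignore the index, and a coalgebra
    -- morphism respects comultiplication.
    refine ⟨g, g, hg.reindex_var, hg.reindex_var, ?_⟩
    obtain ⟨_, e⟩ := hg.coalg (.inl trivial)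
    rw [Res.promAt_rfl] at e
    exact A.coalg_comul (X := S.N.A) (a := S.N.a) (g := g) S.N.counit e
  | @sc _ _ σ _ i i₁ i₂ hi D ih =>
    intro A s r h hs H
    have hD := List.nodup_append'.1 D.nodup
    rw [den_sc, ← Category.assoc, Term.trav_merge]
    refine ih (hs.ite (fun y => y = .svar σ i₁ ∨ y = .svar σ i₂) (.svar σ i))
      (H.contract (.inr trivial) (fun {t g} hg => ?_)
      (fun hm => hD.2.2 hm (by simp)) (fun hm => hD.2.2 hm (by simp)))
    refine ⟨g, g, hg.reindex_svar, hg.reindex_svar, ?_⟩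
    obtain ⟨_, e⟩ := hg.coalg (.inr trivial)
    rw [Res.promAt_rfl] at e
    exact A.coalg_comul (X := (bang L).obj (S.ty _)) (a := (bang L).δ.app (S.ty _)) (g := g)
      ((bang L).left_counit _) e
  | lam i D ih =>
    intro A s r h hs H
    have hx := not_mem_of_nodup_snoc D.nodup
    have := Sem.lam (ih (hs.push _) (H.pushVar hs hx))
    rw [← Term.trav_close _ _ _ _ D.lc] at this
    rw [den_lam, comp_lamMor, ← tensorHom_id]
    rw [← id_tensorHom, Category.assoc, tensorHom_comp_tensorHom_assoc, Category.id_comp,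
      Iso.inv_hom_id] at this
    exact this
  | mu i hΓ hΔ D ih =>
    intro A s r h hs H
    have hx := not_mem_of_nodup_snoc D.nodup
    -- The basis is promotable, which forces the empty resource required by `Sem.mu` and supplies
    -- the condition for `comp_muMor`.
    obtain ⟨rfl, e⟩ := H.coalg fun x hx => (List.mem_append.1 hx).imp (hΓ x) (hΔ x)
    have := Sem.mu (ih (hs.push _) (H.pushSVar hs hx))
    rw [← Term.trav_close _ _ _ _ D.lc] at this
    rw [Res.promAt_rfl] at e
    rw [den_mu, comp_muMor _ _ e, ← tensorHom_id]
    rw [← id_tensorHom, Category.assoc, tensorHom_comp_tensorHom_assoc, Category.id_comp,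
      Iso.inv_hom_id] at this
    exact this

end SlCategory

/-! ### The environment of a basis, and the values being substituted -/

namespace SlCategory

variable {S : SlCategory L} {A : Env S}

theorem Env.ofCtx_mem : ∀ {Γ : Basis} {a : Var ⊕ ℕ} {τ r g}, (ofCtx S Γ).val a τ r g →
    ∃ x ∈ Γ, a = .inl x
  | [], _, _, _, _, h => h.elim
  | x :: Γ, _, _, _, _, h => by
    obtain ⟨⟨⟩⟩ | ⟨h⟩ := h
    · exact ⟨x, by simp, rfl⟩
    · obtain ⟨y, hy, e⟩ := ofCtx_mem h
      exact ⟨y, by simp [hy], e⟩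

/-- Without repetitions every variable is served by exactly one slot. -/
theorem Env.ofCtx_functional {Γ : Basis} (hΓ : Γ.Nodup) : (ofCtx S Γ).Functional := by
  induction Γ with
  | nil => exact fun h => h.elim
  | cons x Γ ih =>
    intro a τ r g τ' r' g' h h'
    rw [List.nodup_cons] at hΓ
    by_cases e : a = .inl x
    · refine PairVal.unique_left (slot_functional (.inl x) x) (fun τ r g k => ?_) h h'
      obtain ⟨y, hy, e'⟩ := ofCtx_mem k
      cases e.symm.trans e'
      exact hΓ.1 hy
    · refine PairVal.unique_right (ih hΓ.2) (fun τ r g k => ?_) h h'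
      cases k
      exact e rfl

theorem val_slot (B : Env S) (x : Var) :
    Val ((Env.slot S (.inl x) x).tensor B) (.fvar x) x
      ((ResHom.fst (S.vres x) B.toRes).R (S.vone x))
      ((ResHom.fst (S.vres x) B.toRes).hom (S.vone x) ≫ (S.viso x).hom) where
  sem := by
    rw [Category.assoc]
    exact .fvar (Env.PairVal.left' (A := Env.slot S (.inl x) x) (B := B) .mk)
  coalg h := by
    obtain ⟨e, he⟩ := slot_coalg (S := S) x h
    refine ⟨congrArg (·, B.nil) e, ?_⟩
    rw [Category.assoc, he, reassoc_of% (ResHom.hom_promAt _ e), Functor.map_comp]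

theorem Vals.tensor_snd (X : Env S) {B : Env S} {Γ : Basis} {r : B.R} {h : B.obj r ⟶ S.ctx Γ}
    (H : Vals B .fvar Γ r h) :
    Vals (X.tensor B) .fvar Γ ((ResHom.snd X.toRes B.toRes).R r)
      ((ResHom.snd X.toRes B.toRes).hom r ≫ h) := by
  refine Vals.map (A := X.tensor B) (B := B) (ResHom.snd X.toRes B.toRes) H
    fun y hy r τ g hg => ?_
  cases hg with
  | fvar hg => exact .fvar (Env.PairVal.right'' (A := X) (B := B) hg)

theorem Vals.cons_tensor {B : Env S} {Γ : Basis} {r : B.R} {h : B.obj r ⟶ S.ctx Γ}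
    (H : Vals B .fvar Γ r h) (x : Var) :
    Vals ((Env.slot S (.inl x) x).tensor B) .fvar (x :: Γ) (S.vone x, r)
      (((S.viso x).hom ⊗ₘ h) ≫ (S.ctxCons x Γ).inv) := by
  have hs : ((S.vres x).tensor B.toRes).Split (S.vone x, r)
      ((ResHom.fst (S.vres x) B.toRes).R (S.vone x)) ((ResHom.snd (S.vres x) B.toRes).R r) :=
    ⟨(S.vres x).split_nil _, B.split_symm (B.split_nil _)⟩
  have e : ((S.vres x).tensor B.toRes).split hs ≫
      ((ResHom.fst (S.vres x) B.toRes).hom (S.vone x) ≫ (S.viso x).hom ⊗ₘ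
        (ResHom.snd (S.vres x) B.toRes).hom r ≫ h) = ((S.viso x).hom ⊗ₘ h) := by
    rw [← tensorHom_comp_tensorHom]
    exact (Category.assoc _ _ _).symm.trans
      ((congrArg (· ≫ ((S.viso x).hom ⊗ₘ h)) (Res.split_fst_snd _ _ _)).trans
        (Category.id_comp _))
  exact of_eq (.cons hs (val_slot B x) (H.tensor_snd _)) ((congrArg
    (· ≫ (S.ctxCons x Γ).inv) e).symm.trans (Category.assoc _ _ _))

/-- The full resource of a basis. -/
def ctxOne (S : SlCategory L) : (Γ : Basis) → (Env.ofCtx S Γ).R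
  | [] => ()
  | x :: Γ => (S.vone x, ctxOne S Γ)

/-- The object of the full resource of a basis. -/
def ctxIso (S : SlCategory L) : (Γ : Basis) → ((Env.ofCtx S Γ).obj (S.ctxOne Γ) ≅ S.ctx Γ)
  | [] => S.ctxNil.symm
  | x :: Γ => (S.viso x ⊗ᵢ ctxIso S Γ) ≪≫ (S.ctxCons x Γ).symm

/-- This is the generic tuple, in which every variable denotes itself. It is invertible, so
equations between interpretations can be tested on it. -/
theorem vals_ctxIso : ∀ Γ : Basis, Vals (Env.ofCtx S Γ) .fvar Γ (S.ctxOne Γ) (S.ctxIso Γ).hom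
  | [] => Vals.of_eq .nil (Category.id_comp _).symm
  | x :: Γ => (vals_ctxIso Γ).cons_tensor x

/-- The substitution of `N` for `x`. -/
def sub (x : Var) (N : Term) (y : Var) : Term := if y = x then N else .fvar y

theorem sub_self (x : Var) (N : Term) : sub x N x = N := if_pos rfl

theorem fvar_eq_sub {x : Var} {N : Term} {Γ : Basis} (hx : x ∉ Γ) :
    ∀ y ∈ Γ, Term.fvar y = sub x N y := by
  intro y hy
  rw [sub, if_neg]
  rintro rfl
  exact hx hy

theorem Sem.sound_fvar {Γ : Basis} {M : Term} {τ : Ty} (D : Deriv Γ M τ) {r : A.R}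
    {h : A.obj r ⟶ S.ctx Γ} (H : Vals A .fvar Γ r h) : Sem A r M τ (h ≫ S.den D) := by
  have hs : Stable S fun _ => .fvar := by
    apply stable_const
    exact fun _ => trivial
  have := Sem.sound D hs H
  rwa [Term.trav_fvar] at this

theorem Sem.sound_sub {Γ : Basis} {M N : Term} {x : Var} {τ : Ty} (hN : Term.LC 0 N)
    (D : Deriv Γ M τ) {r : A.R} {h : A.obj r ⟶ S.ctx Γ} (H : Vals A (sub x N) Γ r h) :
    Sem A r (M.subst x N) τ (h ≫ S.den D) := by
  have hs : Stable S fun _ => sub x N := by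
    apply stable_const
    intro y
    rw [sub]
    split_ifs
    exacts [hN, trivial]
  have := Sem.sound D hs H
  have e : Term.trav (fun _ => sub x N) 0 M = M.subst x N := Term.trav_subst x N M 0
  rwa [e] at this

/-- The map `m` interprets the substitution of `N` for `x`. -/
def IsSub (S : SlCategory L) (x : Var) (N : Term) {Θ Γ : Basis} (m : S.ctx Θ ⟶ S.ctx Γ) : Prop :=
  ∀ ⦃A : Env S⦄ ⦃r : A.R⦄ ⦃h : A.obj r ⟶ S.ctx Θ⦄, Vals A .fvar Θ r h →
    Vals A (sub x N) Γ r (h ≫ m)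

theorem IsSub.sem {x : Var} {N M : Term} {Θ Γ : Basis} {m : S.ctx Θ ⟶ S.ctx Γ}
    (hm : IsSub S x N m) (hN : Term.LC 0 N) {τ : Ty} (D : Deriv Γ M τ) :
    Sem (Env.ofCtx S Θ) (S.ctxOne Θ) (M.subst x N) τ ((S.ctxIso Θ).hom ≫ m ≫ S.den D) := by
  rw [← Category.assoc]
  exact .sound_sub hN D (hm (vals_ctxIso Θ))

/-- On the generic tuple, soundness of `E` under the identity substitution and soundness of `D`
under `sub x N` give two denotations of one term. They agree by uniqueness, and the isomorphism
cancels. -/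
theorem IsSub.den_eq {x : Var} {N M : Term} {Θ Γ : Basis} {m : S.ctx Θ ⟶ S.ctx Γ}
    (hm : IsSub S x N m) (hN : Term.LC 0 N) {τ : Ty} (D : Deriv Γ M τ)
    (E : Deriv Θ (M.subst x N) τ) : S.den E = m ≫ S.den D := by
  have h := Sem.unique (Sem.sound_fvar E (vals_ctxIso Θ)) (Env.ofCtx_functional E.nodup)
    (hm.sem hN D)
  simpa using h

section Numerals

variable (S) in
/-- The value of a numeral. -/
def numMor (i n : ℕ) : 𝟙_ L ⟶ S.var (.var .iota i) := numeral S.zero S.succ n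

variable (S) in
/-- The denotation of a numeral. -/
def numTy (n : ℕ) : 𝟙_ L ⟶ S.ty .iota := numeral S.zero S.succ n

theorem succMor_apMor (n : ℕ) :
    (S.succMor ⊗ₘ S.numTy n) ≫ S.apMor .iota .iota = (λ_ (𝟙_ L)).hom ≫ S.numTy (n + 1) := by
  have : (lcurry ((λ_ S.N.A).hom ≫ S.succ) ⊗ₘ numeral S.zero S.succ n) ≫ leval S.N.A S.N.A =
      (λ_ (𝟙_ L)).hom ≫ numeral S.zero S.succ n ≫ S.succ := by
    rw [lcurry_leval, leftUnitor_naturality_assoc]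
  exact this

theorem sem_num (A : Env S) (n : ℕ) : Sem A A.nil (.num n) .iota (A.drop ≫ S.numTy n) := by
  induction n with
  | zero => exact .zero
  | succ n ih =>
    have := Sem.app (A.split_nil A.nil) .succ ih
    rw [← tensorHom_comp_tensorHom_assoc, succMor_apMor, ← Category.assoc, ← Category.assoc,
      Category.assoc (A.split _), A.split_drop_drop] at this
    exact this

/-- Zero and successor are coalgebra morphisms, hence so are their composites. This qualifies
numerals as values for ground variables. -/
theorem numeral_coalg : ∀ n : ℕ, numeral S.zero S.succ n ≫ S.N.a =
    ε (bang L).toFunctor ≫ (bang L).map (numeral S.zero S.succ n)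
  | 0 => S.zero_coalg
  | n + 1 => by
    rw [numeral, Category.assoc, S.succ_coalg, reassoc_of% (numeral_coalg n), Functor.map_comp]

theorem val_num (A : Env S) (i n : ℕ) :
    Val A (.num n) (.var .iota i) A.nil (A.drop ≫ S.numMor i n) where
  sem := by
    have e : S.numMor i n ≫ S.vev (.var .iota i) = S.numTy n := Category.comp_id _
    have e' : (A.drop ≫ S.numMor i n) ≫ S.vev (.var .iota i) = A.drop ≫ S.numTy n :=
      (Category.assoc _ _ _).trans (congrArg (A.drop ≫ ·) e)
    exact (congrArg (Sem A A.nil (.num n) .iota) e').mpr (sem_num A n)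
  coalg h := by
    have e : S.numMor i n ≫ S.varCoalg (.var .iota i) h =
      ε (bang L).toFunctor ≫ (bang L).map (S.numMor i n) := numeral_coalg n
    refine ⟨rfl, ?_⟩
    rw [Category.assoc, e, Res.promAt_rfl, Functor.map_comp, reassoc_of% A.prom_map_drop]

theorem isSub_num {Γ Δ : Basis} {i : ℕ} (n : ℕ) (hΓ : .var .iota i ∉ Γ)
    (hΔ : .var .iota i ∉ Δ) :
    IsSub S (.var .iota i) (.num n) ((S.split Γ Δ).hom ≫
      (S.ctx Γ ◁ ((λ_ (S.ctx Δ)).inv ≫ (numeral S.zero S.succ n ▷ S.ctx Δ))) ≫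
        (S.split Γ (.var .iota i :: Δ)).inv) := by
  intro A r h H
  obtain ⟨r₁, r₂, hs, h₁, h₂, H₁, H₂, e⟩ := H.append_inv
  have hv := val_num A i n
  rw [← sub_self (.var .iota i) (.num n)] at hv
  refine Vals.of_eq (.append hs (H₁.congr (fvar_eq_sub hΓ)) (.cons (A.split_symm (A.split_nil r₂))
    hv (H₂.congr (fvar_eq_sub hΔ)))) ?_
  rw [reassoc_of% e, reassoc_of% A.drop_split_tensor]
  -- An identity is inserted and then read as `ctxCons`, which brings the map into the form produced
  -- by `Vals.cons`.
  refine (congrArg (fun t : 𝟙_ L ⊗ S.ctx Δ ⟶ S.ctx (.var .iota i :: Δ) => A.split hs ≫ (h₁ ⊗ₘ h₂) ≫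
    (S.ctx Γ ◁ ((λ_ (S.ctx Δ)).inv ≫ t)) ≫ (S.split Γ (.var .iota i :: Δ)).inv)
      (Category.comp_id (S.numMor i n ▷ S.ctx Δ))).symm.trans ?_
  change A.split hs ≫ (h₁ ⊗ₘ h₂) ≫ (S.ctx Γ ◁ ((λ_ (S.ctx Δ)).inv ≫ (S.numMor i n ▷ S.ctx Δ) ≫
    (S.ctxCons (.var .iota i) Δ).inv)) ≫ (S.split Γ (.var .iota i :: Δ)).inv = _
  rw [← id_tensorHom, tensorHom_comp_tensorHom_assoc, Category.comp_id]

end Numerals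

theorem isSub_snoc {Γ Δ : Basis} {x : Var} {N : Term} (hΓ : x ∉ Γ) {k : S.ctx Δ ⟶ S.var x}
    (hk : ∀ {A : Env S} {r : A.R} {h : A.obj r ⟶ S.ctx Δ}, Vals A .fvar Δ r h →
      Val A N x r (h ≫ k)) :
    IsSub S x N ((S.split Γ Δ).hom ≫ (S.ctx Γ ◁ k) ≫ (S.snoc Γ x).inv) := by
  intro A r h H
  obtain ⟨r₁, r₂, hs, h₁, h₂, H₁, H₂, e⟩ := H.append_inv
  have hv := hk H₂
  rw [← sub_self x N] at hv
  refine Vals.of_eq (.snoc hs (H₁.congr (fvar_eq_sub hΓ)) hv) ?_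
  rw [reassoc_of% e, ← id_tensorHom, tensorHom_comp_tensorHom_assoc, Category.comp_id]

/-- A variable of arrow type is neither ground nor stable, so no coalgebra condition arises and any
denotation is a value. -/
theorem val_den {Δ : Basis} {N : Term} {σ₁ σ₂ : Ty} (i : ℕ) (D : Deriv Δ N (.arr σ₁ σ₂))
    {r : A.R} {h : A.obj r ⟶ S.ctx Δ} (H : Vals A .fvar Δ r h) :
    Val A N (.var (.arr σ₁ σ₂) i) r (h ≫ (S.den D : S.ctx Δ ⟶ S.var (.var (.arr σ₁ σ₂) i))) where
  sem := by
    exact (congrArg (Sem A r N (.arr σ₁ σ₂)) (Category.comp_id (h ≫ S.den D))).mpr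
      (.sound_fvar D H)
  coalg h := (h.elim id id : False).elim

/-- The counit undoes the promotion, and naturality of `δ` together with `prom_δ` makes the promoted
map a coalgebra morphism. -/
theorem val_prom {N : Term} {σ : Ty} (i : ℕ) {f : A.obj A.nil ⟶ S.ty σ}
    (h : Sem A A.nil N σ f) :
    Val A N (.svar σ i) A.nil
      (A.prom ≫ ((bang L).map f : (bang L).obj (A.obj A.nil) ⟶ S.var (.svar σ i))) where
  sem := by
    have e : (A.prom ≫ ((bang L).map f : _ ⟶ S.var (.svar σ i))) ≫ S.vev (.svar σ i) = f := by
      change (A.prom ≫ (bang L).map f) ≫ (bang L).ε.app _ = f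
      rw [Category.assoc, Comonad.counit_naturality, reassoc_of% A.prom_ε]
    exact (congrArg (Sem A A.nil N σ) e).mpr h
  coalg _ := by
    refine ⟨rfl, ?_⟩
    rw [Res.promAt_rfl]
    change (A.prom ≫ (bang L).map f) ≫ (bang L).δ.app _ =
      A.prom ≫ (bang L).map (A.prom ≫ (bang L).map f)
    rw [Category.assoc, Comonad.delta_naturality, reassoc_of% A.prom_δ, Functor.map_comp]

theorem val_promote {Δ₁ Δ₂ : Basis} {N : Term} {σ : Ty} (i : ℕ) (hΔ₁ : ∀ x ∈ Δ₁, x.IsGround)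
    (hΔ₂ : ∀ x ∈ Δ₂, x.IsStable) (D : Deriv (Δ₁ ++ Δ₂) N σ) {r : A.R}
    {h : A.obj r ⟶ S.ctx (Δ₁ ++ Δ₂)} (H : Vals A .fvar (Δ₁ ++ Δ₂) r h) :
    Val A N (.svar σ i) r
      (h ≫ (S.promote hΔ₁ hΔ₂ (S.den D) : S.ctx (Δ₁ ++ Δ₂) ⟶ S.var (.svar σ i))) := by
  obtain ⟨rfl, e⟩ := H.coalg fun x hx => (List.mem_append.1 hx).imp (hΔ₁ x) (hΔ₂ x)
  have hv := val_prom i (.sound_fvar D H)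
  have e' : h ≫ S.promote hΔ₁ hΔ₂ (S.den D) = A.prom ≫ (bang L).map (h ≫ S.den D) := by
    rw [Res.promAt_rfl] at e
    rw [Functor.map_comp, ← reassoc_of% e, ctxCoalg, promote, Category.assoc]
  exact (congrArg (Val A N (.svar σ i) A.nil) e').mpr hv

end SlCategory

end

end SlLambda

/-! ### Derivability from finite sets of variables -/

namespace SlLambda

/-- Variables that can be duplicated and discarded. -/
def Var.IsDup (x : Var) : Prop := x.IsGround ∨ x.IsStable

namespace Term

/-- The free variables of a term. -/
def fv : Term → Finset Var
  | lif M P Q => fv M ∪ fv P ∪ fv Q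
  | app M N => fv M ∪ fv N
  | fvar y => {y}
  | lam _ M => fv M
  | mu _ M => fv M
  | _ => ∅

theorem subst_of_notMem {x : Var} {N M : Term} (h : x ∉ fv M) : M.subst x N = M := by
  induction M <;> simp_all [fv, subst]
  rintro rfl
  exact absurd rfl h

theorem subst_fvar_self (x : Var) (M : Term) : M.subst x (fvar x) = M := by
  induction M <;> simp_all [subst]

theorem subst_subst_fvar {x y : Var} {M : Term} (h : y ∉ fv M) :
    (M.subst x (fvar y)).subst y (fvar x) = M := by
  induction M <;> simp_all [fv, subst]
  split_ifs <;> simp_all [subst, eq_comm]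

/-- Replace the dangling index `j` by the free variable `b j`. -/
def opn (b : ℕ → Var) : ℕ → Term → Term
  | _, zero => zero
  | _, succ => succ
  | _, pred => pred
  | d, lif M P Q => lif (opn b d M) (opn b d P) (opn b d Q)
  | d, app M N => app (opn b d M) (opn b d N)
  | _, fvar y => fvar y
  | d, bvar j => if j < d then bvar j else fvar (b (j - d))
  | d, lam σ M => lam σ (opn b (d + 1) M)
  | d, mu σ M => mu σ (opn b (d + 1) M)

/-- Add a name at the front. -/
def nameCons (z : Var) (b : ℕ → Var) : ℕ → Var
  | 0 => z
  | j + 1 => b j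

/-- Naming the outermost dangling index by a fresh `z` and closing `z` again just binds that index.
The other names must avoid `z`, or they would be captured. -/
theorem close_opn {z : Var} {b : ℕ → Var} (hb : ∀ j, b j ≠ z) {M : Term} (h : z ∉ fv M) :
    ∀ d, close z d (opn (nameCons z b) d M) = opn b (d + 1) M := by
  induction M with
  | bvar j =>
    intro d
    simp only [opn]
    rcases lt_trichotomy j d with hj | rfl | hj
    · simp [hj, close, Nat.lt_succ_of_lt hj]
    · simp [close, nameCons]
    · obtain ⟨k, rfl⟩ := Nat.exists_eq_add_of_lt hj
      have e : d + k + 1 - d = k + 1 := by omega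
      have e' : d + k + 1 - (d + 1) = k := by omega
      rw [if_neg (by omega), if_neg (by omega), e, e', nameCons, close, if_neg (hb k)]
  | fvar y =>
    intro d
    simp only [fv, Finset.mem_singleton] at h
    simp [opn, close, Ne.symm h]
  | _ => intro d; simp_all [opn, close, fv]

theorem opn_of_lc {b : ℕ → Var} {M : Term} : ∀ {d}, LC d M → opn b d M = M := by
  induction M <;> intro d h <;> simp_all [opn, LC]

end Term

/-- Variables of the same kind and type. -/
inductive Var.Similar : Var → Var → Prop
  | var (σ i j) : Similar (.var σ i) (.var σ j)
  | svar (σ i j) : Similar (.svar σ i) (.svar σ j)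

theorem Var.Similar.dup {x y : Var} (h : x.Similar y) : x.IsDup → y.IsDup := by
  rcases h with ⟨_ | _, i, j⟩ | ⟨σ, i, j⟩ <;> exact id

theorem Var.Similar.ty_eq {x z : Var} (h : x.Similar z) : z.ty = x.ty := by
  cases h <;> rfl

theorem Var.Similar.refl (x : Var) : x.Similar x := by
  cases x <;> constructor

theorem exists_fresh_var (σ : Ty) (F : Finset Var) : ∃ i, Var.var σ i ∉ F := by
  obtain ⟨i, hi⟩ := Infinite.exists_notMem_finset (F.preimage (Var.var σ) fun _ _ _ _ h => by
    simpa using h)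
  exact ⟨i, fun h => hi (Finset.mem_preimage.2 h)⟩

theorem exists_fresh_svar (σ : Ty) (F : Finset Var) : ∃ i, Var.svar σ i ∉ F := by
  obtain ⟨i, hi⟩ := Infinite.exists_notMem_finset (F.preimage (Var.svar σ) fun _ _ _ _ h => by
    simpa using h)
  exact ⟨i, fun h => hi (Finset.mem_preimage.2 h)⟩

theorem Var.exists_similar (x : Var) (F : Finset Var) : ∃ y, x.Similar y ∧ y ∉ F := by
  rcases x with ⟨σ, i⟩ | ⟨σ, i⟩
  · obtain ⟨j, hj⟩ := exists_fresh_var σ F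
    exact ⟨_, .var _ _ _, hj⟩
  · obtain ⟨j, hj⟩ := exists_fresh_svar σ F
    exact ⟨_, .svar _ _ _, hj⟩

/-- The prefix is arbitrary so that the head of a list can be moved into it, leaving the exchange to
act on the tail. -/
theorem Deriv.perm_append {l l' : Basis} (h : l.Perm l') {M : Term} {τ : Ty} :
    ∀ {Γ : Basis}, Nonempty (Deriv (Γ ++ l) M τ) → Nonempty (Deriv (Γ ++ l') M τ) := by
  induction h with
  | nil => exact id
  | cons x _ ih =>
    intro Γ h
    have := ih (Γ := Γ ++ [x])
    simp only [List.append_assoc, List.cons_append, List.nil_append] at this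
    exact this h
  | swap x y l => exact fun ⟨D⟩ => ⟨.ex D⟩
  | trans _ _ ih₁ ih₂ => exact fun h => ih₂ (ih₁ h)

theorem Deriv.perm {l l' : Basis} (h : l.Perm l') {M : Term} {τ : Ty}
    (D : Nonempty (Deriv l M τ)) : Nonempty (Deriv l' M τ) :=
  perm_append (Γ := []) h D

/-- Derivability from a finite set of variables. -/
def Typ (Γ : Finset Var) (M : Term) (τ : Ty) : Prop :=
  ∃ l : Basis, l.toFinset = Γ ∧ Nonempty (Deriv l M τ)

namespace Typ

variable {Γ Δ : Finset Var} {M N P Q : Term} {σ τ : Ty}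

/-- Derivable bases have no repetitions, so any two admissible listings of a set differ by
exchanges. -/
theorem deriv (h : Typ Γ M τ) {l : Basis} (hl : l.Nodup) (e : l.toFinset = Γ) :
    Nonempty (Deriv l M τ) := by
  obtain ⟨l', e', ⟨D⟩⟩ := h
  refine Deriv.perm ?_ ⟨D⟩
  exact (List.perm_of_nodup_nodup_toFinset_eq D.nodup hl (e'.trans e.symm))

theorem snoc {z : Var} (h : Typ (insert z Γ) M τ) (hz : z ∉ Γ) :
    Nonempty (Deriv (Γ.toList ++ [z]) M τ) := by
  refine h.deriv (List.nodup_append'.2 ⟨Γ.nodup_toList, by simp, by simpa using hz⟩) ?_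
  ext y
  simp

theorem fvar (x : Var) : Typ {x} (.fvar x) x.ty := by
  refine ⟨[x], by simp, ?_⟩
  rcases x with ⟨_ | ⟨σ, τ⟩, i⟩ | ⟨σ, i⟩
  exacts [⟨.gv i⟩, ⟨.hv σ τ i⟩, ⟨.sv σ i⟩]

theorem insert {x : Var} (hx : x.IsDup) (h : Typ Γ M τ) : Typ (insert x Γ) M τ := by
  by_cases hm : x ∈ Γ
  · rwa [Finset.insert_eq_self.2 hm]
  obtain ⟨l, rfl, ⟨D⟩⟩ := h
  refine ⟨l ++ [x], by ext; simp, ?_⟩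
  rw [List.mem_toFinset] at hm
  rcases x with ⟨_ | ⟨σ, τ⟩, i⟩ | ⟨σ, i⟩
  · exact ⟨.gw i hm D⟩
  · exact (hx.elim id id : False).elim
  · exact ⟨.sw i hm D⟩

theorem weaken (h : Typ Γ M τ) (hs : Γ ⊆ Δ) (hd : ∀ x ∈ Δ, x ∉ Γ → x.IsDup) : Typ Δ M τ := by
  have : ∀ E : Finset Var, (∀ x ∈ E, x.IsDup) → Typ (E ∪ Γ) M τ := by
    intro E
    induction E using Finset.induction_on with
    | empty => intro _; simpa using h
    | insert x E _ ih =>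
      intro hE
      rw [Finset.insert_union]
      exact (ih fun y hy => hE y (by simp [hy])).insert (hE x (by simp))
  rw [← Finset.sdiff_union_of_subset hs]
  exact this _ fun x hx => hd x (Finset.mem_sdiff.1 hx).1 (Finset.mem_sdiff.1 hx).2

theorem contract {x x₁ x₂ : Var} (hx : x.IsDup) (h₁ : x.Similar x₁) (h₂ : x.Similar x₂)
    (h : Typ (Insert.insert x₁ (Insert.insert x₂ Γ)) M τ) (hx₁ : x₁ ∉ Γ) (hx₂ : x₂ ∉ Γ)
    (hne : x₁ ≠ x₂) (hxΓ : x ∉ Γ) : Typ (Insert.insert x Γ) (M.merge x x₁ x₂) τ := by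
  obtain ⟨D⟩ := h.deriv (l := Γ.toList ++ [x₁, x₂])
    (List.nodup_append'.2 ⟨Γ.nodup_toList, by simpa using hne, by simp [hx₁, hx₂]⟩)
    (by ext y; simp only [List.mem_toFinset, List.mem_append, Finset.mem_toList, List.mem_cons,
          List.not_mem_nil, or_false, Finset.mem_insert]; tauto)
  refine ⟨Γ.toList ++ [x], by ext; simp, ?_⟩
  have hm : x ∉ Γ.toList := by simpa using hxΓ
  rcases h₁ with ⟨_ | ⟨σ, τ⟩, i, j⟩ | ⟨σ, i, j⟩
  · cases h₂
    exact ⟨.gc _ _ _ hm D⟩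
  · exact (hx.elim id id : False).elim
  · cases h₂
    exact ⟨.sc _ _ _ hm D⟩

/-- Renaming is not a rule of the calculus: the new name is added by weakening and then contracted
with the old one. -/
theorem rename {x y : Var} (hx : x.IsDup) (hs : x.Similar y)
    (h : Typ (Insert.insert x Γ) M τ) (hxΓ : x ∉ Γ) (hyΓ : y ∉ Γ) (hne : x ≠ y) :
    Typ (Insert.insert y Γ) (M.subst x (.fvar y)) τ := by
  have hys : y.Similar x := by cases hs <;> constructor
  have hyy := Var.Similar.refl y
  have := contract (hs.dup hx) hys hyy (by
    rw [Finset.insert_comm]; exact h.insert (hs.dup hx)) hxΓ hyΓ hne hyΓ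
  rwa [Term.merge, Term.subst_fvar_self] at this

/-- Binary rules for disjoint bases are admissible for bases that share variables. -/
theorem share {C : Term → Term} {F : Finset Var}
    (hF : ∀ {x M N}, x ∉ F → (C M).subst x N = C (M.subst x N))
    (hC : ∀ {Γ M}, Disjoint Γ Δ → Typ Γ M σ → Typ (Γ ∪ Δ) (C M) τ) (n : ℕ) :
    ∀ {Γ M}, (Γ ∩ Δ).card = n → (∀ x ∈ Γ, x ∈ Δ → x.IsDup) → Typ Γ M σ → Typ (Γ ∪ Δ) (C M) τ := by
  induction n with
  | zero =>
    intro Γ M hn _ h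
    exact hC (Finset.disjoint_iff_inter_eq_empty.2 (Finset.card_eq_zero.1 hn)) h
  | succ n ih =>
    intro Γ M hn hd h
    obtain ⟨x, hx⟩ : (Γ ∩ Δ).Nonempty := Finset.card_pos.1 (by omega)
    rw [Finset.mem_inter] at hx
    -- One shared variable is renamed apart in the left premise. It will be contracted back after
    -- the rule, and the number of shared variables drops by one.
    obtain ⟨y, hs, hy⟩ := x.exists_similar (Γ ∪ Δ ∪ F ∪ M.fv)
    simp only [Finset.mem_union, not_or] at hy
    obtain ⟨⟨⟨hyΓ, hyΔ⟩, hyF⟩, hyM⟩ := hy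
    have hne : x ≠ y := by rintro rfl; exact hyΓ hx.1
    have hxd := hd x hx.1 hx.2
    have hr : Typ (Insert.insert y (Γ.erase x)) (M.subst x (.fvar y)) σ := by
      refine rename hxd hs ?_ (by simp) (by simp [hyΓ]) hne
      rwa [Finset.insert_erase hx.1]
    have e : Insert.insert y (Γ.erase x) ∩ Δ = (Γ ∩ Δ).erase x := by
      rw [Finset.insert_inter_of_notMem hyΔ, Finset.erase_inter]
    have := ih (by rw [e, Finset.card_erase_of_mem (Finset.mem_inter.2 hx), hn]; rfl)
      (fun z hz hzΔ => by
        rw [Finset.mem_insert] at hz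
        rcases hz with rfl | hz
        · exact (hyΔ hzΔ).elim
        · exact hd z (Finset.mem_of_mem_erase hz) hzΔ) hr
    have hys := Var.Similar.refl x
    have e' : Insert.insert y (Γ.erase x) ∪ Δ =
        Insert.insert y (Insert.insert x ((Γ ∪ Δ).erase x)) := by
      rw [Finset.insert_erase (by simp [hx.1]), Finset.insert_union]
      ext z
      by_cases hz : z = x
      · subst hz; simp [hx.2]
      · simp [hz]
    rw [e'] at this
    have hc := contract hxd hs hys this (by simp [hyΓ, hyΔ]) (by simp) hne.symm (by simp)
    rwa [Finset.insert_erase (by simp [hx.1]), Term.merge, Term.subst_fvar_self, hF hyF,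
      Term.subst_subst_fvar hyM] at hc

theorem app (h₁ : Typ Γ M (.arr σ τ)) (h₂ : Typ Δ N σ) (hd : ∀ x ∈ Γ, x ∈ Δ → x.IsDup) :
    Typ (Γ ∪ Δ) (.app M N) τ := by
  refine share (C := fun M => .app M N) (F := N.fv)
    (fun h => by rw [Term.subst, Term.subst_of_notMem h]) (fun h h₁ => ?_) _ rfl hd h₁
  obtain ⟨l, rfl, ⟨D₁⟩⟩ := h₁
  obtain ⟨l', rfl, ⟨D₂⟩⟩ := h₂
  exact ⟨l ++ l', by simp, ⟨.ap (List.disjoint_toFinset_iff_disjoint.1 h) D₁ D₂⟩⟩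

theorem lif (h : Typ Γ M .iota) (h₁ : Typ Δ P .iota) (h₂ : Typ Δ Q .iota)
    (hd : ∀ x ∈ Γ, x ∈ Δ → x.IsDup) : Typ (Γ ∪ Δ) (.lif M P Q) .iota := by
  refine share (C := fun M => .lif M P Q) (F := P.fv ∪ Q.fv) (fun h => ?_) (fun h h' => ?_) _ rfl
    hd h
  · rw [Finset.mem_union, not_or] at h
    rw [Term.subst, Term.subst_of_notMem h.1, Term.subst_of_notMem h.2]
  · obtain ⟨l, rfl, ⟨D⟩⟩ := h'
    obtain ⟨l', rfl, ⟨D₁⟩⟩ := h₁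
    obtain ⟨D₂⟩ := h₂.deriv D₁.nodup rfl
    exact ⟨l ++ l', by simp, ⟨.lif (List.disjoint_toFinset_iff_disjoint.1 h) D D₁ D₂⟩⟩

theorem lam {i : ℕ} (h : Typ (Insert.insert (.var σ i) Γ) M τ) (hi : .var σ i ∉ Γ) :
    Typ Γ (.abs σ i M) (.arr σ τ) := by
  obtain ⟨D⟩ := h.snoc hi
  exact ⟨Γ.toList, by simp, ⟨.lam i D⟩⟩

open Classical in
theorem mu {i : ℕ} (h : Typ (Insert.insert (.svar σ i) Γ) M σ) (hi : .svar σ i ∉ Γ)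
    (hd : ∀ x ∈ Γ, x.IsDup) : Typ Γ (.fix σ i M) σ := by
  obtain ⟨D⟩ := h.snoc hi
  -- The fixpoint rule asks for ground variables before stable ones; filtering sorts the basis
  -- accordingly.
  have hp := List.filter_append_perm (fun x : Var => decide x.IsGround) Γ.toList
  obtain ⟨D'⟩ := Deriv.perm (hp.symm.append_right [.svar σ i]) ⟨D⟩
  refine ⟨_, ?_, ⟨.mu i (fun x hx => ?_) (fun x hx => ?_) D'⟩⟩
  · rw [List.toFinset_eq_of_perm _ _ hp, Finset.toList_toFinset]
  · simpa using (List.mem_filter.1 hx).2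
  · rw [List.mem_filter] at hx
    exact (hd x (by simpa using hx.1)).resolve_left (by simpa using hx.2)

end Typ

end SlLambda

/-! ### From denotations back to derivations -/

namespace SlLambda

noncomputable section

variable {L : Type u} [Category.{v} L] [MonoidalCategory L] [SymmetricCategory L]
  [MonoidalClosed L] [LinearCategory L]

/-- Finite sets of variables for the resources. -/
structure Bases (A : Res L) where
  bas : A.R → Finset Var
  all : Finset Var
  bas_sub : ∀ r, bas r ⊆ all
  nil_dup : ∀ x ∈ bas A.nil, x.IsDup
  split : ∀ {r r₁ r₂}, A.Split r r₁ r₂ → bas r = bas r₁ ∪ bas r₂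
  split_dup : ∀ {r r₁ r₂}, A.Split r r₁ r₂ → ∀ x ∈ bas r₁, x ∈ bas r₂ → x.IsDup

/-- The variables of a tensor product. -/
def Bases.tensor {A B : Res L} (a : Bases A) (b : Bases B) (h : Disjoint a.all b.all) :
    Bases (A.tensor B) where
  bas r := a.bas r.1 ∪ b.bas r.2
  all := a.all ∪ b.all
  bas_sub r := Finset.union_subset_union (a.bas_sub _) (b.bas_sub _)
  nil_dup x hx := (Finset.mem_union.1 hx).elim (a.nil_dup x) (b.nil_dup x)
  split hs := by
    rw [a.split hs.1, b.split hs.2, Finset.union_union_union_comm]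
  split_dup {r r₁ r₂} hs x h₁ h₂ := by
    have hab {r s} (ha : x ∈ a.bas r) (hb : x ∈ b.bas s) : x.IsDup :=
      (Finset.disjoint_left.1 h (a.bas_sub _ ha) (b.bas_sub _ hb)).elim
    obtain h₁ | h₁ := Finset.mem_union.1 h₁ <;> obtain h₂ | h₂ := Finset.mem_union.1 h₂
    · exact a.split_dup hs.1 x h₁ h₂
    · exact hab h₁ h₂
    · exact hab h₂ h₁
    · exact b.split_dup hs.2 x h₁ h₂

/-- The variables of a duplicable resource. -/
def Bases.dup {A : Res L} (z : Var) (h : z.IsDup) : Bases A where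
  bas _ := {z}
  all := {z}
  bas_sub _ := Finset.Subset.refl _
  nil_dup x hx := by rwa [Finset.mem_singleton.1 hx]
  split _ := (Finset.union_self _).symm
  split_dup _ x hx _ := by rwa [Finset.mem_singleton.1 hx]

/-- The variables of a linear resource. -/
def Bases.lin (X : L) (z : Var) : Bases (Res.lin X) where
  bas r := bif r then {z} else ∅
  all := {z}
  bas_sub r := by cases (r : Bool) <;> simp
  nil_dup x hx := by simp [Res.lin] at hx
  split {r r₁ r₂} hs := by
    change Bool at r r₁ r₂
    change r = (r₁ || r₂) ∧ (r₁ && r₂) = false at hs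
    revert r r₁ r₂
    simp
  split_dup {r r₁ r₂} hs x h₁ h₂ := by
    change Bool at r r₁ r₂
    change r = (r₁ || r₂) ∧ (r₁ && r₂) = false at hs
    cases r₁ <;> cases r₂ <;> simp at hs h₁ h₂

variable [HasFiniteProducts L]

namespace SlCategory

variable (S : SlCategory L)

/-- The variables of the resource of a variable. -/
def varBases : (x z : Var) → x.Similar z → Bases (S.vres x)
  | .var .iota _, z, h => .dup z (h.dup (.inl trivial))
  | .var (.arr σ τ) _, z, _ => .lin (S.ty (.arr σ τ)) z
  | .svar _ _, z, h => .dup z (h.dup (.inr trivial))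

theorem varBases_all : ∀ (x z : Var) (h : x.Similar z), (S.varBases x z h).all = {z}
  | .var .iota _, _, _ => rfl
  | .var (.arr _ _) _, _, _ => rfl
  | .svar _ _, _, _ => rfl

theorem varBases_one :
    ∀ (x z : Var) (h : x.Similar z), (S.varBases x z h).bas (S.vone x) = {z}
  | .var .iota _, _, _ => rfl
  | .var (.arr _ _) _, _, _ => rfl
  | .svar _ _, _, _ => rfl

theorem varBases_nil_dup (x z : Var) (h : x.Similar z) :
    ∀ y ∈ (S.varBases x z h).bas (S.vres x).nil, y.IsDup :=
  (S.varBases x z h).nil_dup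

variable {S}

/-- `y` is the only variable of `F` that cannot be discarded. -/
def Main (y : Var) (τ : Ty) (F : Finset Var) : Prop :=
  y.ty = τ ∧ y ∈ F ∧ ∀ z ∈ F, z ≠ y → z.IsDup

theorem Main.typ {y : Var} {τ : Ty} {F : Finset Var} (h : Main y τ F) : Typ F (.fvar y) τ := by
  obtain ⟨rfl, hy, hd⟩ := h
  exact (Typ.fvar y).weaken (by simpa using hy) fun z hz hne => hd z hz (by simpa using hne)

theorem Main.union_right {y : Var} {τ : Ty} {F G : Finset Var} (h : Main y τ F)
    (hG : ∀ x ∈ G, x.IsDup) : Main y τ (F ∪ G) :=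
  ⟨h.1, Finset.mem_union_left _ h.2.1, fun z hz hne =>
    (Finset.mem_union.1 hz).elim (fun hz => h.2.2 z hz hne) (hG z)⟩

theorem Main.union_left {y : Var} {τ : Ty} {F G : Finset Var} (h : Main y τ F)
    (hG : ∀ x ∈ G, x.IsDup) : Main y τ (G ∪ F) := by
  rw [Finset.union_comm]
  exact h.union_right hG

/-- Names for the variables of an environment. -/
structure Names (A : Env S) extends Bases A.toRes where
  name : ℕ → Var
  name_mem : ∀ j, name j ∈ all
  free : ∀ {y τ r g}, A.val (.inl y) τ r g → Main y τ (bas r)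
  bound : ∀ {j τ r g}, A.val (.inr j) τ r g → Main (name j) τ (bas r)

theorem main_varBases (x z : Var) (h : x.Similar z) :
    Main z x.ty ((S.varBases x z h).bas (S.vone x)) := by
  rw [varBases_one]
  exact ⟨h.ty_eq, by simp, fun y hy hne => absurd (Finset.mem_singleton.1 hy) hne⟩

/-- Extend the names by a bound variable. -/
def Names.ext {A : Env S} (N : Names A) (x z : Var) (h : x.Similar z) (hz : z ∉ N.all) :
    Names (A.ext x) where
  toBases := Bases.tensor (A := A.shift.toRes) N.toBases (S.varBases x z h) (by
    rw [varBases_all]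
    simpa using hz)
  name := Term.nameCons z N.name
  name_mem j := by
    cases j with
    | zero => exact Finset.mem_union_right _ (by rw [varBases_all]; simp [Term.nameCons])
    | succ j => exact Finset.mem_union_left _ (N.name_mem j)
  free := by
    rintro y τ r g (⟨h'⟩ | ⟨⟨⟩⟩)
    exact (N.free h').union_right (varBases_nil_dup _ _ _ _)
  bound := by
    rintro (_ | j) τ r g (⟨h'⟩ | ⟨⟨⟩⟩)
    · exact h'.elim
    · exact (main_varBases x z h).union_left N.nil_dup
    · exact (N.bound h').union_right (varBases_nil_dup _ _ _ _)

theorem exists_bases_ofCtx {Γ : Basis} (hΓ : Γ.Nodup) :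
    ∃ b : Bases (Env.ofCtx S Γ).toRes, b.all = Γ.toFinset ∧ b.bas (S.ctxOne Γ) = Γ.toFinset ∧
      ∀ {y τ r g}, (Env.ofCtx S Γ).val (.inl y) τ r g → Main y τ (b.bas r) := by
  induction Γ with
  | nil =>
    exact ⟨⟨fun _ => ∅, ∅, by simp, by simp, fun _ => rfl, by simp⟩, rfl, rfl, fun h => h.elim⟩
  | cons x Γ ih =>
    rw [List.nodup_cons] at hΓ
    obtain ⟨b, h₁, h₂, h₃⟩ := ih hΓ.2
    have hx := Var.Similar.refl x
    refine ⟨Bases.tensor (A := S.vres x) (B := (Env.ofCtx S Γ).toRes) (S.varBases x x hx) b ?_,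
      ?_, ?_, ?_⟩
    · rw [varBases_all, h₁]
      simpa using hΓ.1
    · simp only [Bases.tensor]
      rw [varBases_all, h₁, List.toFinset_cons]
      rfl
    · simp only [Bases.tensor, ctxOne]
      rw [varBases_one, h₂, List.toFinset_cons]
      rfl
    · rintro y τ r g (⟨⟨⟩⟩ | ⟨h⟩)
      · exact (main_varBases x x hx).union_right b.nil_dup
      · exact (h₃ h).union_left (varBases_nil_dup _ _ _ _)

theorem Names.exists_ofCtx {Γ : Basis} (hΓ : Γ.Nodup) :
    ∃ N : Names (Env.ofCtx S Γ), N.bas (S.ctxOne Γ) = Γ.toFinset := by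
  obtain ⟨b, -, h₁, h₂⟩ := exists_bases_ofCtx (S := S) hΓ
  refine ⟨{ b with
    -- The environment of a basis has no bound variables, so all names are one dummy, added to `all`
    -- only because names must lie there.
    all := insert (.svar .iota 0) b.all
    bas_sub := fun r => (b.bas_sub r).trans (Finset.subset_insert _ _)
    name := fun _ => .svar .iota 0
    name_mem := fun _ => Finset.mem_insert_self _ _
    free := h₂
    bound := fun h => ?_ }, h₁⟩
  obtain ⟨_, _, ⟨⟩⟩ := Env.ofCtx_mem h

/-- Terms with a denotation are typable. -/
theorem Sem.typ {A : Env S} {r : A.R} {M : Term} {τ : Ty} {g : A.obj r ⟶ S.ty τ}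
    (h : Sem A r M τ g) : ∀ N : Names A, Typ (N.bas r) (M.opn N.name 0) τ := by
  have hz {M τ F} (h : Nonempty (Deriv [] M τ)) (hF : ∀ x ∈ F, x.IsDup) : Typ F M τ :=
    Typ.weaken (Γ := ∅) ⟨[], rfl, h⟩ (Finset.empty_subset _) fun x hx _ => hF x hx
  induction h with
  | zero => exact fun N => hz ⟨.z⟩ N.nil_dup
  | succ => exact fun N => hz ⟨.s⟩ N.nil_dup
  | pred => exact fun N => hz ⟨.p⟩ N.nil_dup
  | fvar h => exact fun N => (N.free h).typ
  | bvar h => exact fun N => (N.bound h).typ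
  | app h h₁ h₂ ih₁ ih₂ =>
    intro N
    rw [N.split h]
    exact (ih₁ N).app (ih₂ N) (N.split_dup h)
  | lif h h₁ h₂ h₃ ih₁ ih₂ ih₃ =>
    intro N
    rw [N.split h]
    exact (ih₁ N).lif (ih₂ N) (ih₃ N) (N.split_dup h)
  | @lam A r σ τ M f h ih =>
    intro N
    -- The name of the bound variable avoids the names in use and the free variables of the body, so
    -- that closing it captures nothing else.
    obtain ⟨i, hi⟩ := exists_fresh_var σ (N.all ∪ M.fv)
    rw [Finset.mem_union, not_or] at hi
    have := ih (N.ext (.var σ 0) (.var σ i) (.var σ 0 i) hi.1)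
    simp only [Names.ext, Bases.tensor] at this
    rw [varBases_one, Finset.union_comm, ← Finset.insert_eq] at this
    have := this.lam fun hm => hi.1 (N.bas_sub _ hm)
    rwa [Term.abs, Term.close_opn (fun j hj => hi.1 (by rw [← hj]; exact N.name_mem j))
      hi.2] at this
  | @mu A σ M f h ih =>
    intro N
    obtain ⟨i, hi⟩ := exists_fresh_svar σ (N.all ∪ M.fv)
    rw [Finset.mem_union, not_or] at hi
    have := ih (N.ext (.svar σ 0) (.svar σ i) (.svar σ 0 i) hi.1)
    simp only [Names.ext, Bases.tensor] at this
    rw [varBases_one, Finset.union_comm, ← Finset.insert_eq] at this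
    have := this.mu (fun hm => hi.1 (N.bas_sub _ hm)) N.nil_dup
    rwa [Term.fix, Term.close_opn (fun j hj => hi.1 (by rw [← hj]; exact N.name_mem j))
      hi.2] at this

theorem LC_subst {x : Var} {N M : Term} (hN : ∀ k, Term.LC k N) :
    ∀ {k}, Term.LC k M → Term.LC k (M.subst x N) := by
  induction M <;> intro k h <;> simp_all [Term.LC, Term.subst]
  split_ifs <;> simp [Term.LC, hN]

theorem LC_mono {M : Term} : ∀ {k l}, k ≤ l → Term.LC k M → Term.LC l M := by
  induction M <;> intro k l hk h <;> simp_all [Term.LC]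
  · rename_i h₁ h₂ h₃
    exact ⟨h₁ hk h.1, h₂ hk h.2.1, h₃ hk h.2.2⟩
  · rename_i h₁ h₂
    exact ⟨h₁ hk h.1, h₂ hk h.2⟩
  · omega
  · rename_i ih
    exact ih (Nat.succ_le_succ hk) h
  · rename_i ih
    exact ih (Nat.succ_le_succ hk) h

/-- The full resource of `Θ` carries exactly the variables of `Θ`, and the substituted term is
locally closed, so `Sem.typ` gives a derivation from `Θ` itself. The threefold composite is the
common shape of the three substitution maps. -/
theorem IsSub.main {x : Var} {N M : Term} {Θ Γ : Basis} {X Y : L} {a : S.ctx Θ ⟶ X} {b : X ⟶ Y}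
    {c : Y ⟶ S.ctx Γ} (hm : IsSub S x N (a ≫ b ≫ c)) (hΘ : Θ.Nodup) (hN : Term.LC 0 N) {τ : Ty}
    (D : Deriv Γ M τ) : Nonempty (Deriv Θ (M.subst x N) τ) ∧
      ∀ E : Deriv Θ (M.subst x N) τ, S.den E = a ≫ b ≫ c ≫ S.den D := by
  refine ⟨?_, fun E => by rw [hm.den_eq hN D E, Category.assoc, Category.assoc]⟩
  obtain ⟨Ns, e⟩ := Names.exists_ofCtx (S := S) hΘ
  have := (hm.sem hN D).typ Ns
  rw [e, Term.opn_of_lc (LC_subst (fun k => LC_mono (Nat.zero_le k) hN) D.lc)] at this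
  exact this.deriv hΘ rfl

end SlCategory

end

end SlLambda

theorem mainTheorem2 {L : Type u} [Category.{v} L] [MonoidalCategory L] [SymmetricCategory L]
    [MonoidalClosed L] [HasFiniteProducts L] [SlLambda.LinearCategory L]
    (S : SlLambda.SlCategory L) :
    -- numerals for ground variables
    (∀ (Γ Δ : SlLambda.Basis) (i n : ℕ) (M : SlLambda.Term) (σ : SlLambda.Ty)
        (D : SlLambda.Deriv (Γ ++ .var .iota i :: Δ) M σ),
      Nonempty (SlLambda.Deriv (Γ ++ Δ) (M.subst (.var .iota i) (.num n)) σ) ∧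
      ∀ E : SlLambda.Deriv (Γ ++ Δ) (M.subst (.var .iota i) (.num n)) σ,
        S.den E =
          (S.split Γ Δ).hom ≫
            (S.ctx Γ ◁ ((λ_ (S.ctx Δ)).inv ≫
              (SlLambda.numeral S.zero S.succ n ▷ S.ctx Δ))) ≫
            (S.split Γ (.var .iota i :: Δ)).inv ≫ S.den D) ∧
    -- terms for higher-order variables
    (∀ (Γ Δ : SlLambda.Basis) (i : ℕ) (M N : SlLambda.Term) (σ₁ σ₂ τ : SlLambda.Ty)
        (D : SlLambda.Deriv (Γ ++ [.var (.arr σ₁ σ₂) i]) M τ)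
        (D' : SlLambda.Deriv Δ N (.arr σ₁ σ₂)), Γ.Disjoint Δ →
      Nonempty (SlLambda.Deriv (Γ ++ Δ) (M.subst (.var (.arr σ₁ σ₂) i) N) τ) ∧
      ∀ E : SlLambda.Deriv (Γ ++ Δ) (M.subst (.var (.arr σ₁ σ₂) i) N) τ,
        S.den E =
          (S.split Γ Δ).hom ≫ (S.ctx Γ ◁ S.den D') ≫
            (S.snoc Γ (.var (.arr σ₁ σ₂) i)).inv ≫ S.den D) ∧
    -- terms for stable variables
    (∀ (Γ Δ₁ Δ₂ : SlLambda.Basis) (i : ℕ) (M N : SlLambda.Term) (σ τ : SlLambda.Ty)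
        (hΔ₁ : ∀ x ∈ Δ₁, x.IsGround) (hΔ₂ : ∀ x ∈ Δ₂, x.IsStable)
        (D : SlLambda.Deriv (Γ ++ [.svar σ i]) M τ)
        (D' : SlLambda.Deriv (Δ₁ ++ Δ₂) N σ), Γ.Disjoint (Δ₁ ++ Δ₂) →
      Nonempty (SlLambda.Deriv (Γ ++ (Δ₁ ++ Δ₂)) (M.subst (.svar σ i) N) τ) ∧
      ∀ E : SlLambda.Deriv (Γ ++ (Δ₁ ++ Δ₂)) (M.subst (.svar σ i) N) τ,
        S.den E =
          (S.split Γ (Δ₁ ++ Δ₂)).hom ≫ (S.ctx Γ ◁ S.promote hΔ₁ hΔ₂ (S.den D')) ≫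
            (S.snoc Γ (.svar σ i)).inv ≫ S.den D) := by
  refine ⟨fun Γ Δ i n M σ D => ?_, fun Γ Δ i M N σ₁ σ₂ τ D D' hd => ?_,
    fun Γ Δ₁ Δ₂ i M N σ τ h₁ h₂ D D' hd => ?_⟩
  · obtain ⟨hΓ, hΔ, hd⟩ := List.nodup_append'.1 D.nodup
    rw [List.nodup_cons] at hΔ
    exact (SlLambda.SlCategory.isSub_num (S := S) n (fun hm => hd hm (by simp)) hΔ.1).main
      (List.nodup_append'.2 ⟨hΓ, hΔ.2, fun y hy hy' => hd hy (by simp [hy'])⟩)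
      (SlLambda.Term.LC.num n 0) D
  · obtain ⟨hΓ, -, -⟩ := List.nodup_append'.1 D.nodup
    exact (SlLambda.SlCategory.isSub_snoc (SlLambda.not_mem_of_nodup_snoc D.nodup)
      (SlLambda.SlCategory.val_den i D')).main (List.nodup_append'.2 ⟨hΓ, D'.nodup, hd⟩) D'.lc D
  · obtain ⟨hΓ, -, -⟩ := List.nodup_append'.1 D.nodup
    exact (SlLambda.SlCategory.isSub_snoc (SlLambda.not_mem_of_nodup_snoc D.nodup)
      (SlLambda.SlCategory.val_promote i h₁ h₂ D')).main
      (List.nodup_append'.2 ⟨hΓ, D'.nodup, hd⟩) D'.lc D
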